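/- Let $d\ge 2$, let $e_1,\dots,e_d$ be the canonical basis of $\mathbb{Z}^d$, $\mathcal{E}_+=\{e_1,\dots,e_d\}$ and $\mathcal{E}=\{\pm e_1,\dots,\pm e_d\}$. Let $k,\ell\ge 1$, let $E_1,\dots,E_k,F_1,\dots,F_\ell\subset\mathcal{E}$, and put $\underline{E}=\bigcap_i E_i$, $\overline{E}=\bigcup_i E_i$, $\underline{F}=\bigcap_j F_j$. Assume that $e_1\in\underline{E}$, $\overline{E}\subset\mathcal{E}_+$ and $\mathcal{E}\setminus\underline{E}\subset\underline{F}$. Let $p\in[0,1]$, and let $(r_1,\dots,r_k)$ and $(q_1,\dots,q_\ell)$ be probability vectors. Let $(U_x)_{x\in\mathbb{Z}^d}$, $(U'_x)_{x\in\mathbb{Z}^d}$ be i.i.d. random variables, uniform on $(0,1]$, on a probability space. For each $x\in\mathbb{Z}^d$ set $\mathcal{G}_x=E_i$ if $U_x<p$ and $U'_x\in[\sum_{j<i}r_j,\sum_{j\le i}r_j)$, and $\mathcal{G}_x=F_i$ if $U_x\ge p$ and $U'_x\in[\sum_{j<i}q_j,\sum_{j\le i}q_j)$ (if $U'_x$ lies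 in no such interval, which has probability $0$, set $\mathcal{G}_x=\varnothing$). Consider the random directed graph on $\mathbb{Z}^d$ with an arrow from $x$ to $x+e$ for every $x\in\mathbb{Z}^d$ and $e\in\mathcal{G}_x$. Let $\mathcal{B}_o$ be the set of $y\in\mathbb{Z}^d$ from which the origin $o$ can be reached by following arrows (in zero or more steps), and let $\mathcal{B}_o^*$ be the set obtained in the same way, from the same $U_x,U'_x$, when every $F_j$ is replaced by $\mathcal{E}$. Then almost surely at least one of the following holds: (i) for every $i\in\{2,\dots,d\}$ and $z\in\mathbb{Z}^d$, every connected component (for the nearest-neighbour graph of $\mathbb{Z}^d$) of $\{x\in\mathcal{B}_o: x^{[m]}=z^{[m]}\text{ for all } m\ne 1,i\}$ is finite, where $x^{[m]}$ is the $m$-th coordinate of $x$; (ii) $\mathcal{B}_o=\mathcal{B}_o^*$; (iii) $\mathcal{B}_o=\{z+ke_1: z\in\mathcal{B}_o,\ k\in\mathbb{Z},\ k\ge 0\}\ne\mathbb{Z}^d$ and $\mathcal{B}_o^*=\mathbb{Z}^d$. -/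

import Mathlib

open MeasureTheory ProbabilityTheory

namespace DRE

/-- The vertex set `ℤ^d`; coordinate `0 : Fin d` is the first coordinate. -/
abbrev Site (d : ℕ) : Type := Fin d → ℤ

/-- The first canonical basis vector `e_1` of `ℤ^d`. -/
def e₁ (d : ℕ) [NeZero d] : Site d := Pi.single 0 1

/-- The set of canonical basis vectors `e_1, …, e_d`. -/
def posUnits (d : ℕ) : Set (Site d) := {e | ∃ i : Fin d, e = Pi.single i 1}

/-- The set of all unit vectors `± e_i`. -/
def units (d : ℕ) : Set (Site d) := posUnits d ∪ {e | ∃ i : Fin d, e = -Pi.single i 1}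

/-- The standing condition on the families `E = (E_1, …, E_k)`, `F = (F_1, …, F_ℓ)`. -/
structure ModelCondition {d k l : ℕ} [NeZero d]
    (E : Fin k → Set (Site d)) (F : Fin l → Set (Site d)) : Prop where
  two_le : 2 ≤ d
  e₁_mem : e₁ d ∈ ⋂ i, E i
  iUnion_subset : (⋃ i, E i) ⊆ posUnits d
  diff_subset : units d \ (⋂ i, E i) ⊆ ⋂ j, F j

/-- The half-open interval `[∑_{j<i} r_j, ∑_{j≤i} r_j)`. -/
def cell {k : ℕ} (r : Fin k → ℝ) (i : Fin k) : Set ℝ :=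
  Set.Ico (∑ j ∈ Finset.Iio i, r j) (∑ j ∈ Finset.Iic i, r j)

/-- The local environment at a site with labels `u`, `u'`: it is `E_i` if `u < p` and `u'` lies
in the `i`-th cell of `r`, and `F_i` if `u ≥ p` and `u'` lies in the `i`-th cell of `q`.
(The cells are disjoint; the set is empty if `u'` lies in no cell, an event of probability 0.) -/
def localEnv {d k l : ℕ} (E : Fin k → Set (Site d)) (F : Fin l → Set (Site d))
    (r : Fin k → ℝ) (q : Fin l → ℝ) (p u u' : ℝ) : Set (Site d) :=
  {e | (u < p ∧ ∃ i, u' ∈ cell r i ∧ e ∈ E i) ∨ (p ≤ u ∧ ∃ i, u' ∈ cell q i ∧ e ∈ F i)}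

/-- The environment `x ↦ 𝒢_x` determined by a realisation `u`, `u'` of the labels. -/
def env {d k l : ℕ} (E : Fin k → Set (Site d)) (F : Fin l → Set (Site d))
    (r : Fin k → ℝ) (q : Fin l → ℝ) (p : ℝ) (u u' : Site d → ℝ) : Site d → Set (Site d) :=
  fun x => localEnv E F r q p (u x) (u' x)

/-- The forward cluster of `x`: the sites reachable from `x` by following arrows
`y → y + e`, `e ∈ G y`. -/
def forwardCluster {d : ℕ} (G : Site d → Set (Site d)) (x : Site d) : Set (Site d) :=
  {y | Relation.ReflTransGen (fun a b => ∃ e ∈ G a, b = a + e) x y}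

/-- The backward cluster of `x`: the sites from which `x` can be reached. -/
def backwardCluster {d : ℕ} (G : Site d → Set (Site d)) (x : Site d) : Set (Site d) :=
  {y | x ∈ forwardCluster G y}

/-- The nearest neighbour graph on `ℤ^d`. -/
def latticeGraph (d : ℕ) : SimpleGraph (Site d) :=
  SimpleGraph.fromRel (fun x y => y - x ∈ units d)

/-- The plane through `z` spanned by the first and the `i`-th coordinate direction. -/
def plane {d : ℕ} [NeZero d] (i : Fin d) (z : Site d) : Set (Site d) :=
  {x | ∀ k : Fin d, k ≠ 0 → k ≠ i → x k = z k}

/-- `A` is semi-finite: each connected component of each two-dimensional slice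
`plane i z ∩ A`, `i ≠ 1`, is finite. -/
def SemiFinite {d : ℕ} [NeZero d] (A : Set (Site d)) : Prop :=
  ∀ i : Fin d, i ≠ 0 → ∀ z : Site d,
    ∀ c : ((latticeGraph d).induce (plane i z ∩ A)).ConnectedComponent, c.supp.Finite

/-- `A_{1+}`: the union of the half-lines `{z + k e_1 : k ≥ 0}`, `z ∈ A`. -/
def onePlus {d : ℕ} [NeZero d] (A : Set (Site d)) : Set (Site d) :=
  ⋃ z ∈ A, {x | ∃ k : ℕ, x = z + k • e₁ d}

end DRE

/-! A site of the first type (`U x ω < p`) offers every direction common to all `E i`, among them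
`e₁ d`; a site of the second type offers every other unit vector, in particular all negative ones.
Arrows starting outside the backward cluster `B` stay outside. So, in a plane spanned by the first
and the `i`-th direction, each site outside `B` starts a path outside `B` which moves right until it
can step down, and another which moves left or right (according to whether the `i`-th basis vector
is common to all `E i`) until it can step up. Together they form a barrier that nearest-neighbour
paths in `B` cannot cross (`PlaneRule.exists_isBarrier`).

For `0 < p < 1`, two such paths driven by the same environment coalesce almost surely
(`ae_exists_flow_eq`): their mean gap does not grow, and while the gap is bounded they merge in each
row with probability bounded below. Hence the region between two barriers is finite, and a site of
an infinite planar component has all barriers on one side, which makes it the end of a horizontal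
ray in `B` (`PlaneRule.exists_ray`). Such a ray spreads to neighbours in `B`, so all of `B` is
closed under a step of `e₁ d`, or all of it under a step of `-e₁ d`. Closure to the left forces `B =
B*` (`IsEnrichment.eq_of_left_closed`); closure to the right forces `B*` to be everything
(`IsEnrichment.eq_univ_of_right_closed`). For `p = 0` and `p = 1` only one type of site occurs, and
the claim is direct. -/

open scoped ENNReal

/-! ### Stops in a row and the paths they drive. -/

namespace DRE

/-- The first `j ≥ a` with `s j` (equal to `a` if there is none). -/
noncomputable def nextStop (s : ℤ → Prop) (a : ℤ) : ℤ := a + (sInf {k : ℕ | s (a + k)} : ℕ)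

/-- The path which moves in row `n` from its present column to the next stop of that row and
then enters row `n + 1`; `flow s a n` is the column at which row `n` is entered. -/
noncomputable def flow (s : ℕ → ℤ → Prop) (a : ℤ) : ℕ → ℤ
  | 0 => a
  | n + 1 => nextStop (s n) (flow s a n)

theorem le_nextStop (s : ℤ → Prop) (a : ℤ) : a ≤ nextStop s a := by
  unfold nextStop; omega

theorem nextStop_spec {s : ℤ → Prop} {a b : ℤ} (hab : a ≤ b) (hb : s b) : s (nextStop s a) := by
  have hne : {k : ℕ | s (a + k)}.Nonempty := by
    refine ⟨(b - a).toNat, ?_⟩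
    have : a + ((b - a).toNat : ℤ) = b := by omega
    rwa [Set.mem_ofPred_eq, this]
  exact Nat.sInf_mem hne

theorem not_of_lt_nextStop {s : ℤ → Prop} {a j : ℤ} (haj : a ≤ j) (hj : j < nextStop s a) :
    ¬ s j := by
  intro hs
  have hmem : (j - a).toNat ∈ {k : ℕ | s (a + k)} := by
    have : a + ((j - a).toNat : ℤ) = j := by omega
    rwa [Set.mem_ofPred_eq, this]
  have := Nat.sInf_le hmem
  unfold nextStop at hj
  omega

theorem nextStop_le {s : ℤ → Prop} {a b : ℤ} (hab : a ≤ b) (hb : s b) : nextStop s a ≤ b := by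
  by_contra h
  exact not_of_lt_nextStop hab (not_le.1 h) hb

theorem nextStop_eq_self {s : ℤ → Prop} {a : ℤ} (h : ∀ j, a ≤ j → ¬ s j) : nextStop s a = a := by
  have : {k : ℕ | s (a + k)} = ∅ := by
    ext k; simpa using h (a + k) (by omega)
  simp [nextStop, this]

theorem nextStop_mono {s : ℤ → Prop} {a b : ℤ} (hab : a ≤ b) :
    nextStop s a ≤ nextStop s b := by
  by_cases h : ∃ j, b ≤ j ∧ s j
  · obtain ⟨j, hj, hs⟩ := h
    exact nextStop_le (hab.trans (le_nextStop s b)) (nextStop_spec hj hs)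
  · push Not at h
    by_contra hlt
    have hb : b < nextStop s a := lt_of_le_of_lt (le_nextStop s b) (not_le.1 hlt)
    by_cases h' : ∃ j, a ≤ j ∧ s j
    · obtain ⟨j, hj, hs⟩ := h'
      exact h _ hb.le (nextStop_spec hj hs)
    · push Not at h'
      rw [nextStop_eq_self h'] at hb
      omega

/-- The stop `c` excludes the default value, under which the two sides would be `a` and `b`. -/
theorem nextStop_eq_of_no_stop {s : ℤ → Prop} {a b c : ℤ} (hab : a ≤ b)
    (h : ∀ j, a ≤ j → j < b → ¬ s j) (hbc : b ≤ c) (hc : s c) :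
    nextStop s a = nextStop s b := by
  refine le_antisymm (nextStop_mono hab) (nextStop_le ?_ (nextStop_spec (hab.trans hbc) hc))
  by_contra hlt
  exact h _ (le_nextStop s a) (not_le.1 hlt) (nextStop_spec (hab.trans hbc) hc)

/-- Peels off the first row instead of the last, as needed to condition on row `0`. -/
theorem flow_succ' (s : ℕ → ℤ → Prop) (a : ℤ) (n : ℕ) :
    flow s a (n + 1) = flow (fun i => s (i + 1)) (nextStop (s 0) a) n := by
  induction n with
  | zero => rfl
  | succ n ih => rw [flow, ih]; rfl

/-! ### Measurability of stops and paths. -/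

section Measurability

variable {Ω : Type*} {m : MeasurableSpace Ω}

theorem measurable_nextStop {A : ℤ → Set Ω} (hA : ∀ j, MeasurableSet (A j)) (a : ℤ) :
    Measurable fun ω => nextStop (fun j => ω ∈ A j) a := by
  have h : Measurable fun ω => sInf {k : ℕ | ω ∈ A (a + k)} := by
    refine measurable_to_countable' fun k => ?_
    -- The second alternative accounts for `sInf ∅ = 0`.
    have : (fun ω => sInf {k : ℕ | ω ∈ A (a + k)}) ⁻¹' {k} =
        {ω | (ω ∈ A (a + k) ∧ ∀ j : ℕ, j < k → ω ∉ A (a + j)) ∨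
          (k = 0 ∧ ∀ j : ℕ, ω ∉ A (a + j))} := by
      ext ω
      simp only [Set.mem_preimage, Set.mem_singleton_iff, Set.mem_ofPred_eq]
      constructor
      · rintro rfl
        by_cases hne : {k : ℕ | ω ∈ A (a + k)}.Nonempty
        · exact Or.inl ⟨Nat.sInf_mem hne, fun j hj => Nat.notMem_of_lt_sInf hj⟩
        · rw [Set.not_nonempty_iff_eq_empty] at hne
          refine Or.inr ⟨by simp [hne], fun j hj => ?_⟩
          have : j ∈ {k : ℕ | ω ∈ A (a + k)} := hj
          simp [hne] at this
      · rintro (⟨h1, h2⟩ | ⟨rfl, h2⟩)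
        · refine le_antisymm (Nat.sInf_le h1) ?_
          by_contra hlt
          exact h2 _ (not_le.1 hlt) (Nat.sInf_mem (s := {k : ℕ | ω ∈ A (a + k)}) ⟨k, h1⟩)
        · have : {k : ℕ | ω ∈ A (a + k)} = ∅ := by
            ext j; simpa using h2 j
          simp [this]
    rw [this]
    have h1 : MeasurableSet {ω | ∀ j : ℕ, j < k → ω ∉ A (a + j)} := by
      have : {ω | ∀ j : ℕ, j < k → ω ∉ A (a + j)} = ⋂ j : ℕ, ⋂ _ : j < k, (A (a + j))ᶜ := by
        ext; simp
      rw [this]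
      exact MeasurableSet.iInter fun j => MeasurableSet.iInter fun _ => (hA _).compl
    have h2 : MeasurableSet {ω | ∀ j : ℕ, ω ∉ A (a + j)} := by
      have : {ω | ∀ j : ℕ, ω ∉ A (a + j)} = ⋂ j : ℕ, (A (a + j))ᶜ := by
        ext; simp
      rw [this]
      exact MeasurableSet.iInter fun j => (hA _).compl
    exact ((hA _).inter h1).union ((MeasurableSet.const _).inter h2)
  exact (measurable_of_countable fun k : ℕ => a + (k : ℤ)).comp h

theorem measurable_flow {A : ℕ → ℤ → Set Ω} (hA : ∀ n j, MeasurableSet (A n j)) (a : ℤ) (n : ℕ) :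
    Measurable fun ω => flow (fun i j => ω ∈ A i j) a n := by
  induction n with
  | zero => exact measurable_const
  | succ n ih =>
    have h : Measurable fun q : ℤ × Ω => nextStop (fun j => q.2 ∈ A n j) q.1 :=
      measurable_from_prod_countable_right fun b => measurable_nextStop (hA n) b
    exact h.comp (ih.prodMk measurable_id)

theorem measurableSet_flow_ne {A : ℕ → ℤ → Set Ω} (hA : ∀ n j, MeasurableSet (A n j))
    (a b : ℤ) (n : ℕ) :
    MeasurableSet {ω | flow (fun i j => ω ∈ A i j) a n ≠ flow (fun i j => ω ∈ A i j) b n} :=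
  (measurableSet_eq_fun (measurable_flow hA a n) (measurable_flow hA b n)).compl

end Measurability

/-! ### A single row of independent stops of density `θ`. -/

section Row

variable {Ω : Type*} {mΩ : MeasurableSpace Ω} {P : Measure Ω} [IsProbabilityMeasure P]
  {m : ℤ → MeasurableSpace Ω} {A : ℤ → Set Ω} {θ : ℝ≥0∞}

theorem measure_no_stop (hm : ∀ j, m j ≤ mΩ) (hind : iIndep m P)
    (hA : ∀ j, MeasurableSet[m j] (A j)) (hθ : ∀ j, P (A j) = θ) (a : ℤ) (n : ℕ) :
    P (⋂ i ∈ Finset.range n, (A (a + i))ᶜ) = (1 - θ) ^ n := by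
  have hind' : iIndep (fun i : ℕ => m (a + i)) P :=
    hind.precomp (g := fun i : ℕ => a + (i : ℤ)) (fun i j h => by simpa using h)
  rw [hind'.meas_biInter (fun i _ => (hA _).compl)]
  simp [prob_compl_eq_one_sub (hm _ _ (hA _)), hθ]

theorem measure_stop_no_stop (hm : ∀ j, m j ≤ mΩ) (hind : iIndep m P)
    (hA : ∀ j, MeasurableSet[m j] (A j)) (hθ : ∀ j, P (A j) = θ) (a : ℤ) (n : ℕ) :
    P (A a ∩ ⋂ i ∈ Finset.range n, (A (a + 1 + i))ᶜ) = θ * (1 - θ) ^ n := by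
  have hind' : iIndep (fun i : ℕ => m (a + i)) P :=
    hind.precomp (g := fun i : ℕ => a + (i : ℤ)) (fun i j h => by simpa using h)
  have key := hind'.meas_biInter (S := Finset.range (n + 1))
    (s := fun i => if i = 0 then A a else (A (a + i))ᶜ) (fun i _ => by
      by_cases h : i = 0
      · subst h; simpa using (add_zero a).symm ▸ hA a
      · simpa [h] using (hA _).compl)
  rw [Finset.prod_range_succ'] at key
  have h2 : ∀ j : ℕ, P (A (a + j))ᶜ = 1 - θ := fun j => by
    rw [prob_compl_eq_one_sub (hm _ _ (hA _)), hθ]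
  have h3 : (⋂ i ∈ Finset.range (n + 1), if i = 0 then A a else (A (a + (i : ℕ)))ᶜ) =
      A a ∩ ⋂ i ∈ Finset.range n, (A (a + 1 + (i : ℕ)))ᶜ := by
    ext ω
    simp only [Set.mem_iInter, Finset.mem_range, Set.mem_inter_iff]
    constructor
    · intro h
      refine ⟨by simpa using h 0 (by omega), fun i hi => ?_⟩
      have := h (i + 1) (by omega)
      simpa [add_assoc, add_comm (1 : ℤ)] using this
    · rintro ⟨h0, h1⟩ i hi
      rcases i with _ | i
      · simpa using h0
      · simpa [add_assoc, add_comm (1 : ℤ)] using h1 i (by omega)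
  rw [h3] at key
  rw [key]
  have h4 : ∀ j : ℕ, P (if j + 1 = 0 then A a else (A (a + ((j + 1 : ℕ) : ℤ)))ᶜ) = 1 - θ :=
    fun j => by rw [if_neg (by omega), h2]
  simp only [h4]
  simp [hθ, mul_comm]

theorem ae_exists_stop (hm : ∀ j, m j ≤ mΩ) (hind : iIndep m P)
    (hA : ∀ j, MeasurableSet[m j] (A j)) (hθ : ∀ j, P (A j) = θ) (h0 : θ ≠ 0) :
    ∀ᵐ ω ∂P, ∀ a : ℤ, ∃ j, a ≤ j ∧ ω ∈ A j := by
  rw [ae_all_iff]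
  intro a
  rw [ae_iff]
  have hlt : 1 - θ < 1 := ENNReal.sub_lt_self (by simp) (by simp) h0
  refine le_antisymm (ge_of_tendsto' (ENNReal.tendsto_pow_atTop_nhds_zero_of_lt_one hlt)
    fun n => ?_) bot_le
  rw [← measure_no_stop hm hind hA hθ a n]
  refine measure_mono fun ω hω => ?_
  simp only [Set.mem_iInter]
  intro i _ hmem
  exact hω ⟨_, by omega, hmem⟩

/-- The two next stops differ only if `a` is itself a stop. The difference is then the number of `n`
for which the `n` columns after `a` are free, and `∑ θ (1 - θ) ^ n = 1`. Thus the mean gap between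
two paths does not grow. -/
theorem lintegral_nextStop_succ_sub_le (hm : ∀ j, m j ≤ mΩ) (hind : iIndep m P)
    (hA : ∀ j, MeasurableSet[m j] (A j)) (hθ : ∀ j, P (A j) = θ) (h0 : θ ≠ 0) (a : ℤ) :
    ∫⁻ ω, ((nextStop (fun j => ω ∈ A j) (a + 1) - nextStop (fun j => ω ∈ A j) a).toNat : ℝ≥0∞) ∂P
      ≤ 1 := by
  have hle : θ ≤ 1 := hθ a ▸ prob_le_one
  have hmeas : ∀ n : ℕ, MeasurableSet (A a ∩ ⋂ i ∈ Finset.range n, (A (a + 1 + i))ᶜ) := fun n =>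
    (hm _ _ (hA a)).inter (Finset.measurableSet_biInter _ fun i _ => (hm _ _ (hA _)).compl)
  calc _ ≤ ∫⁻ ω, ∑' n : ℕ, (A a ∩ ⋂ i ∈ Finset.range n, (A (a + 1 + i))ᶜ).indicator 1 ω ∂P := by
        refine lintegral_mono_ae ?_
        filter_upwards [ae_exists_stop hm hind hA hθ h0] with ω hω
        obtain ⟨c, hc, hcs⟩ := hω (a + 1)
        by_cases ha : ω ∈ A a
        · have h1 : nextStop (fun j => ω ∈ A j) a = a :=
            le_antisymm (nextStop_le le_rfl ha) (le_nextStop _ _)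
          set D := (nextStop (fun j => ω ∈ A j) (a + 1) - nextStop (fun j => ω ∈ A j) a).toNat
            with hD
          refine le_trans ?_ (ENNReal.sum_le_tsum (Finset.range D))
          have : ∀ n ∈ Finset.range D,
              (A a ∩ ⋂ i ∈ Finset.range n, (A (a + 1 + (i : ℕ)))ᶜ).indicator
                (1 : Ω → ℝ≥0∞) ω = 1 := by
            intro n hn
            rw [Set.indicator_of_mem, Pi.one_apply]
            refine ⟨ha, ?_⟩
            simp only [Set.mem_iInter, Finset.mem_range] at hn ⊢
            intro i hi
            exact not_of_lt_nextStop (s := fun j => ω ∈ A j) (a := a + 1) (by omega) (by omega)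
          rw [Finset.sum_congr rfl this]
          simp
        · have h1 : nextStop (fun j => ω ∈ A j) a = nextStop (fun j => ω ∈ A j) (a + 1) :=
            nextStop_eq_of_no_stop (by omega) (fun j h1 h2 => by
              obtain rfl : j = a := by omega
              exact ha) hc hcs
          simp [h1]
    _ = ∑' n : ℕ, θ * (1 - θ) ^ n := by
        rw [lintegral_tsum fun n => (measurable_one.indicator (hmeas n)).aemeasurable]
        refine tsum_congr fun n => ?_
        rw [lintegral_indicator_one (hmeas n), measure_stop_no_stop hm hind hA hθ]
    _ ≤ 1 := by
        rw [ENNReal.tsum_mul_left, ENNReal.tsum_geometric,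
          ENNReal.sub_sub_cancel ENNReal.one_ne_top hle]
        exact ENNReal.mul_inv_le_one θ

theorem lintegral_nextStop_sub_le (hm : ∀ j, m j ≤ mΩ) (hind : iIndep m P)
    (hA : ∀ j, MeasurableSet[m j] (A j)) (hθ : ∀ j, P (A j) = θ) (h0 : θ ≠ 0) (a : ℤ) (n : ℕ) :
    ∫⁻ ω, ((nextStop (fun j => ω ∈ A j) (a + n) - nextStop (fun j => ω ∈ A j) a).toNat : ℝ≥0∞) ∂P
      ≤ n := by
  have hmeas := measurable_nextStop (fun j => hm _ _ (hA j))
  induction n with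
  | zero => simp
  | succ n ih =>
    calc _ ≤ ∫⁻ ω, (((nextStop (fun j => ω ∈ A j) (a + n) -
            nextStop (fun j => ω ∈ A j) a).toNat : ℝ≥0∞) +
          ((nextStop (fun j => ω ∈ A j) (a + n + 1) -
            nextStop (fun j => ω ∈ A j) (a + n)).toNat : ℝ≥0∞)) ∂P := by
          refine lintegral_mono fun ω => ?_
          rw [show a + ((n + 1 : ℕ) : ℤ) = a + n + 1 by push_cast; ring, ← Nat.cast_add]
          exact Nat.cast_le.2 (by omega)
      _ ≤ n + 1 := by
          rw [lintegral_add_left]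
          · exact add_le_add ih (lintegral_nextStop_succ_sub_le hm hind hA hθ h0 _)
          · exact (measurable_of_countable fun k : ℤ => (k.toNat : ℝ≥0∞)).comp
              ((hmeas _).sub (hmeas _))
      _ = _ := by push_cast; rfl

/-- The paths merge in this row whenever none of the `n` columns from `a` to `a + n - 1` is a stop.
-/
theorem measure_nextStop_ne_le (hm : ∀ j, m j ≤ mΩ) (hind : iIndep m P)
    (hA : ∀ j, MeasurableSet[m j] (A j)) (hθ : ∀ j, P (A j) = θ) (h0 : θ ≠ 0) (a : ℤ) (n : ℕ) :
    P {ω | nextStop (fun j => ω ∈ A j) a ≠ nextStop (fun j => ω ∈ A j) (a + n)}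
      ≤ 1 - (1 - θ) ^ n := by
  rw [← measure_no_stop hm hind hA hθ a n, ← prob_compl_eq_one_sub
    (Finset.measurableSet_biInter _ fun i _ => (hm _ _ (hA _)).compl)]
  refine measure_mono_ae ?_
  filter_upwards [ae_exists_stop hm hind hA hθ h0] with ω hω hne hmem
  obtain ⟨c, hc, hcs⟩ := hω (a + n)
  refine hne (nextStop_eq_of_no_stop (by omega) (fun j h1 h2 => ?_) hc hcs)
  simp only [Set.mem_iInter, Finset.mem_range] at hmem
  have := hmem (j - a).toNat (by omega)
  rwa [show a + ((j - a).toNat : ℤ) = j by omega] at this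

end Row

/-! ### Coalescence of two paths in the same environment. -/

section Coalescence

variable {Ω : Type*} {mΩ : MeasurableSpace Ω} {P : Measure Ω} [IsProbabilityMeasure P] {θ : ℝ≥0∞}

/-- The first term pays for the gap ever reaching `N`, as in a maximal inequality; the second for
failing to merge in `n` rows with gap below `N`. The environment is quantified after `n` because the
induction shifts it by one row. -/
theorem measure_flow_ne_le (h0 : θ ≠ 0) {N : ℕ} (hN : N ≠ 0) (n : ℕ) :
    ∀ {m : ℕ × ℤ → MeasurableSpace Ω} {A : ℕ → ℤ → Set Ω} (_ : ∀ i, m i ≤ mΩ) (_ : iIndep m P)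
    (_ : ∀ i j, MeasurableSet[m (i, j)] (A i j)) (_ : ∀ i j, P (A i j) = θ) {a b : ℤ} (_ : a ≤ b),
    P {ω | flow (fun i j => ω ∈ A i j) a n ≠ flow (fun i j => ω ∈ A i j) b n}
      ≤ (b - a).toNat / N + (1 - (1 - θ) ^ N) ^ n := by
  induction n with
  | zero =>
    intro m A hm hind hA hθ a b hab
    exact prob_le_one.trans (by simp)
  | succ n ih =>
    intro m A hm hind hA hθ a b hab
    rcases le_or_gt N (b - a).toNat with hD | hD
    · refine prob_le_one.trans (le_trans ?_ le_self_add)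
      rw [ENNReal.le_div_iff_mul_le (by simp [hN]) (by simp), one_mul]
      exact_mod_cast hD
    have hA' : ∀ i j, MeasurableSet (A i j) := fun i j => hm _ _ (hA i j)
    have hrow : iIndep (fun j => m (0, j)) P :=
      hind.precomp (g := fun j : ℤ => ((0 : ℕ), j)) (fun i j h => by simpa using h)
    have hrest : iIndep (fun q : ℕ × ℤ => m (q.1 + 1, q.2)) P :=
      hind.precomp (g := fun q : ℕ × ℤ => (q.1 + 1, q.2))
        (fun q q' h => by simpa [Prod.ext_iff] using h)
    set f : Ω → ℤ × ℤ := fun ω =>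
      (nextStop (fun j => ω ∈ A 0 j) a, nextStop (fun j => ω ∈ A 0 j) b) with hf
    set V : ℤ × ℤ → Set Ω := fun q =>
      {ω | flow (fun i j => ω ∈ A (i + 1) j) q.1 n ≠ flow (fun i j => ω ∈ A (i + 1) j) q.2 n}
      with hV
    have hfm : Measurable f := (measurable_nextStop (hA' 0) a).prodMk (measurable_nextStop (hA' 0) b)
    -- The induction hypothesis for the pair of columns `q` entered in row `1`; the indicator drops
    -- the second term for pairs that have merged.
    let g : ℤ × ℤ → ℝ≥0∞ := fun q =>
      (q.2 - q.1).toNat / N + {q : ℤ × ℤ | q.1 ≠ q.2}.indicator (fun _ => (1 - (1 - θ) ^ N) ^ n) q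
    -- `f` depends on row `0` only, `V q` on the later rows only.
    have hind2 : ∀ q, P (f ⁻¹' {q} ∩ V q) = P (f ⁻¹' {q}) * P (V q) := by
      intro q
      have hdis : Disjoint (Set.range fun j : ℤ => ((0 : ℕ), j))
          (Set.range fun q : ℕ × ℤ => (q.1 + 1, q.2)) := by
        rw [Set.disjoint_left]
        rintro _ ⟨j, rfl⟩ ⟨q, hq⟩
        simp at hq
      have hI := indep_iSup_of_disjoint hm hind hdis
      refine Indep_iff _ _ _ |>.1 hI _ _ ?_ ?_
      · have hA0 : ∀ j, MeasurableSet[⨆ i ∈ Set.range fun j : ℤ => ((0 : ℕ), j), m i] (A 0 j) :=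
          fun j => le_biSup m (Set.mem_range_self j) _ (hA 0 j)
        exact ((measurable_nextStop hA0 a).prodMk (measurable_nextStop hA0 b))
          (measurableSet_singleton q)
      · refine measurableSet_flow_ne (A := fun i j => A (i + 1) j) (fun i j => ?_) _ _ _
        exact le_biSup m (Set.mem_range_self (f := fun q : ℕ × ℤ => (q.1 + 1, q.2)) (i, j)) _
          (hA _ _)
    calc P {ω | flow (fun i j => ω ∈ A i j) a (n + 1) ≠ flow (fun i j => ω ∈ A i j) b (n + 1)}
        ≤ P (⋃ q, f ⁻¹' {q} ∩ V q) := by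
          refine measure_mono fun ω hω => Set.mem_iUnion.2 ⟨f ω, rfl, ?_⟩
          simpa only [hV, hf, Set.mem_ofPred_eq, flow_succ'] using hω
      _ ≤ ∑' q, P (f ⁻¹' {q} ∩ V q) := measure_iUnion_le _
      _ ≤ ∑' q, g q * P.map f {q} := by
          refine ENNReal.tsum_le_tsum fun q => ?_
          rw [Measure.map_apply hfm (measurableSet_singleton q)]
          -- Only attained pairs are known to be ordered, as the induction hypothesis requires.
          by_cases hne : (f ⁻¹' {q}).Nonempty
          · obtain ⟨ω, rfl⟩ := hne
            rw [hind2, mul_comm]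
            gcongr
            have hle : (f ω).1 ≤ (f ω).2 := nextStop_mono (s := fun j => ω ∈ A 0 j) hab
            by_cases heq : (f ω).1 = (f ω).2
            · simp [hV, heq]
            · refine (ih (m := fun q : ℕ × ℤ => m (q.1 + 1, q.2)) (A := fun i j => A (i + 1) j)
                (fun _ => hm _) hrest (fun i j => hA _ _) (fun i j => hθ _ _) hle).trans ?_
              simp only [g]
              rw [Set.indicator_of_mem (by exact heq)]
          · rw [Set.not_nonempty_iff_eq_empty] at hne
            simp [hne]
      _ = ∫⁻ ω, g (f ω) ∂P := by
          rw [← lintegral_countable', lintegral_map (measurable_of_countable g) hfm]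
      _ = (∫⁻ ω, (((f ω).2 - (f ω).1).toNat : ℝ≥0∞) ∂P) / N +
            (1 - (1 - θ) ^ N) ^ n * P {ω | (f ω).1 ≠ (f ω).2} := by
          simp only [g]
          have hm1 : Measurable fun ω => (((f ω).2 - (f ω).1).toNat : ℝ≥0∞) / N :=
            (measurable_of_countable fun q : ℤ × ℤ => ((q.2 - q.1).toNat : ℝ≥0∞) / N).comp hfm
          rw [lintegral_add_left hm1]
          congr 1
          · simp only [div_eq_mul_inv]
            exact lintegral_mul_const _ ((measurable_of_countable
              fun q : ℤ × ℤ => ((q.2 - q.1).toNat : ℝ≥0∞)).comp hfm)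
          · exact lintegral_indicator_const
              (hfm (Set.to_countable {q : ℤ × ℤ | q.1 ≠ q.2}).measurableSet) _
      _ ≤ (b - a).toNat / N + (1 - (1 - θ) ^ N) ^ n * (1 - (1 - θ) ^ N) := by
          have hb : a + ((b - a).toNat : ℤ) = b := by omega
          have h1 := lintegral_nextStop_sub_le (m := fun j => m (0, j)) (fun j => hm _) hrow
            (hA 0) (hθ 0) h0 a (b - a).toNat
          have h2 := measure_nextStop_ne_le (m := fun j => m (0, j)) (fun j => hm _) hrow
            (hA 0) (hθ 0) h0 a (b - a).toNat
          rw [hb] at h1 h2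
          gcongr
          refine h2.trans (tsub_le_tsub_left ?_ 1)
          exact pow_le_pow_right_of_le_one' tsub_le_self hD.le
      _ = _ := by rw [pow_succ]

/-- Two paths which follow the same environment coalesce. -/
theorem ae_exists_flow_eq {m : ℕ × ℤ → MeasurableSpace Ω} {A : ℕ → ℤ → Set Ω}
    (hm : ∀ i, m i ≤ mΩ) (hind : iIndep m P)
    (hA : ∀ i j, MeasurableSet[m (i, j)] (A i j)) (hθ : ∀ i j, P (A i j) = θ)
    (h0 : θ ≠ 0) (h1 : θ < 1) :
    ∀ᵐ ω ∂P, ∀ a b, ∃ n, flow (fun i j => ω ∈ A i j) a n = flow (fun i j => ω ∈ A i j) b n := by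
  have key : ∀ a b : ℤ, a ≤ b →
      ∀ᵐ ω ∂P, ∃ n, flow (fun i j => ω ∈ A i j) a n = flow (fun i j => ω ∈ A i j) b n := by
    intro a b hab
    rw [ae_iff]
    -- The number of rows tends to infinity first, at fixed gap threshold `N + 1`; only then does
    -- `N`.
    have hbound : ∀ N : ℕ, P {ω | ¬ ∃ n, flow (fun i j => ω ∈ A i j) a n =
        flow (fun i j => ω ∈ A i j) b n} ≤ (b - a).toNat / ((N + 1 : ℕ) : ℝ≥0∞) := by
      intro N
      have hlt : 1 - (1 - θ) ^ (N + 1) < 1 :=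
        ENNReal.sub_lt_self (by simp) (by simp) (pow_ne_zero _ (tsub_pos_of_lt h1).ne')
      have ht := (ENNReal.tendsto_pow_atTop_nhds_zero_of_lt_one hlt).const_add
        (((b - a).toNat : ℝ≥0∞) / ((N + 1 : ℕ) : ℝ≥0∞))
      rw [add_zero] at ht
      refine ge_of_tendsto' ht fun n => le_trans (measure_mono fun ω hω => ?_)
        (measure_flow_ne_le h0 N.succ_ne_zero n hm hind hA hθ hab)
      exact fun h => hω ⟨n, h⟩
    have hz : Filter.Tendsto (fun N : ℕ => ((b - a).toNat : ℝ≥0∞) / ((N + 1 : ℕ) : ℝ≥0∞))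
        Filter.atTop (nhds 0) :=
      (Filter.tendsto_add_atTop_iff_nat (f := fun N : ℕ => ((b - a).toNat : ℝ≥0∞) / (N : ℝ≥0∞))
        1).2 (ENNReal.Tendsto.const_div ENNReal.tendsto_nat_nhds_top (by simp) |>.trans (by simp))
    exact le_antisymm (ge_of_tendsto' hz hbound) bot_le
  simp only [ae_all_iff]
  intro a b
  rcases le_total a b with h | h
  · exact key a b h
  · filter_upwards [key b a h] with ω ⟨n, hn⟩
    exact ⟨n, hn.symm⟩

end Coalescence

end DRE

/-! ### Barriers in a plane. -/

namespace DRE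

/-- From some row on, `x` moves from row to row along the stops of `s`. -/
def EventuallyFlow (s : ℤ → ℤ → Prop) (x : ℤ → ℤ) : Prop :=
  ∃ k₀, ∀ k, k₀ ≤ k → x (k + 1) = nextStop (s k) (x k)

/-- Any two paths started in the same row coalesce. -/
def Coalesces (s : ℤ → ℤ → Prop) : Prop :=
  ∀ k a b, ∃ n, flow (fun i => s (k + i)) a n = flow (fun i => s (k + i)) b n

theorem EventuallyFlow.exists_eq {s : ℤ → ℤ → Prop} {x y : ℤ → ℤ} (hs : Coalesces s)
    (hx : EventuallyFlow s x) (hy : EventuallyFlow s y) : ∃ k₀, ∀ k, k₀ ≤ k → x k = y k := by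
  obtain ⟨k₁, h₁⟩ := hx
  obtain ⟨k₂, h₂⟩ := hy
  have key : ∀ {w : ℤ → ℤ}, (∀ k, max k₁ k₂ ≤ k → w (k + 1) = nextStop (s k) (w k)) →
      ∀ n : ℕ, w (max k₁ k₂ + n) = flow (fun i => s (max k₁ k₂ + i)) (w (max k₁ k₂)) n := by
    intro w hw n
    induction n with
    | zero => simp [flow]
    | succ n ih =>
      rw [flow, ← ih, ← hw _ (by omega)]
      push_cast
      rw [add_assoc]
  have hx' := key (w := x) fun k hk => h₁ k (by omega)
  have hy' := key (w := y) fun k hk => h₂ k (by omega)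
  obtain ⟨n, hn⟩ := hs (max k₁ k₂) (x (max k₁ k₂)) (y (max k₁ k₂))
  rw [← hx', ← hy'] at hn
  refine ⟨max k₁ k₂ + n, fun k hk => ?_⟩
  obtain ⟨i, rfl⟩ : ∃ i : ℕ, k = max k₁ k₂ + n + i := ⟨(k - (max k₁ k₂ + n)).toNat, by omega⟩
  induction i with
  | zero => simpa using hn
  | succ i ih =>
    push_cast
    rw [← add_assoc, h₁ _ (by omega), h₂ _ (by omega), ih (by omega)]

/-- The rules satisfied by the trace `b` on a plane of a set which is closed under backward steps.
Rows are indexed by the first argument and columns by the second one, `t` holds at the sites of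
the first type, and `c` tells whether these have the upward arrow. -/
structure PlaneRule (c : Prop) (b t : ℤ → ℤ → Prop) : Prop where
  right : ∀ h j, ¬ b h j → t h j → ¬ b h (j + 1)
  left : ∀ h j, ¬ b h j → ¬ t h j → ¬ b h (j - 1)
  down : ∀ h j, ¬ b h j → ¬ t h j → ¬ b (h - 1) j
  up : c → ∀ h j, ¬ b h j → t h j → ¬ b (h + 1) j
  up' : ¬ c → ∀ h j, ¬ b h j → ¬ t h j → ¬ b (h + 1) j
  exists_left : ∀ h a, ∃ j, j ≤ a ∧ t h j
  exists_right : ∀ h a, ∃ j, a ≤ j ∧ ¬ t h j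

/-- A family of intervals `[lo h, hi h]` in the rows of the plane, disjoint from `b`, such that
intervals in consecutive rows overlap; far down and far up it follows the flow of `t`. -/
structure IsBarrier (c : Prop) (b t : ℤ → ℤ → Prop) (lo hi : ℤ → ℤ) : Prop where
  le : ∀ h, lo h ≤ hi h
  disjoint : ∀ h j, lo h ≤ j → j ≤ hi h → ¬ b h j
  overlap : ∀ h, lo (h + 1) ≤ hi h
  overlap' : ∀ h, lo h ≤ hi (h + 1)
  down : EventuallyFlow (fun k j => ¬ t (-k) j) fun k => lo (-k)
  up : c → EventuallyFlow (fun k j => t k (-j)) fun k => -hi k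
  up' : ¬ c → EventuallyFlow (fun k j => ¬ t k j) lo

/-- Applied with `r` the complement of the cluster, this keeps the whole path outside it, including
the sites passed between entering a row and leaving it. -/
theorem flow_mem {s r : ℕ → ℤ → Prop} (hrow : ∀ n j, r n j → ¬ s n j → r n (j + 1))
    (hcol : ∀ n j, r n j → s n j → r (n + 1) j) (hex : ∀ n a, ∃ j, a ≤ j ∧ s n j)
    {a : ℤ} (ha : r 0 a) (n : ℕ) {j : ℤ} (h₁ : flow s a n ≤ j) (h₂ : j ≤ flow s a (n + 1)) :
    r n j := by
  have key : ∀ n : ℕ, r n (flow s a n) → ∀ i : ℕ, flow s a n + i ≤ flow s a (n + 1) →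
      r n (flow s a n + i) := by
    intro n hn i
    induction i with
    | zero => intro _; simpa using hn
    | succ i ih =>
      intro hi
      push_cast at hi ⊢
      rw [← add_assoc]
      exact hrow _ _ (ih (by omega)) (not_of_lt_nextStop (a := flow s a n) (by omega)
        (by rw [flow] at hi; omega))
  have h : ∀ n, r n (flow s a n) := by
    intro n
    induction n with
    | zero => exact ha
    | succ n ih =>
      have hle : flow s a n ≤ flow s a (n + 1) := le_nextStop _ _
      have := key n ih (flow s a (n + 1) - flow s a n).toNat (by omega)
      rw [show flow s a n + ((flow s a (n + 1) - flow s a n).toNat : ℤ) = flow s a (n + 1) by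
        omega] at this
      obtain ⟨j, hj, hs⟩ := hex n (flow s a n)
      exact hcol _ _ this (nextStop_spec hj hs)
  have := key n (h n) (j - flow s a n).toNat (by omega)
  rwa [show flow s a n + ((j - flow s a n).toNat : ℤ) = j by omega] at this

/-- Through every site outside of `b` there is a barrier. -/
theorem PlaneRule.exists_isBarrier {c : Prop} {b t : ℤ → ℤ → Prop} (H : PlaneRule c b t)
    {h a : ℤ} (ha : ¬ b h a) :
    ∃ lo hi, IsBarrier c b t lo hi ∧ lo h ≤ a ∧ a ≤ hi h := by
  -- Lower half of the barrier: right along sites of the first type, down at the first site of the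
  -- second type.
  obtain ⟨x, hx0, hxmono, hxs, hxb⟩ : ∃ x : ℕ → ℤ, x 0 = a ∧ (∀ n, x n ≤ x (n + 1)) ∧
      (∀ n : ℕ, x (n + 1) = nextStop (fun j => ¬ t (h - n) j) (x n)) ∧
      ∀ (n : ℕ) j, x n ≤ j → j ≤ x (n + 1) → ¬ b (h - n) j := by
    refine ⟨flow (fun n j => ¬ t (h - n) j) a, rfl, fun n => le_nextStop _ _, fun n => rfl,
      fun n j => flow_mem (r := fun n j => ¬ b (h - n) j) ?_ ?_ ?_ (by simpa using ha) n⟩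
    · exact fun n j h1 h2 => H.right _ _ h1 (not_not.1 h2)
    · intro n j h1 h2
      have := H.down _ _ h1 h2
      rwa [show h - (n : ℤ) - 1 = h - (n + 1 : ℕ) by push_cast; ring] at this
    · exact fun n a => H.exists_right _ a
  -- Upper half. Under `c` it runs left until a site of the first type, so it is a flow in mirrored
  -- columns; otherwise it runs right until a site of the second type.
  obtain ⟨L, U, hL0, hU0, hLU, hov, hov', hb, hc, hc'⟩ : ∃ L U : ℕ → ℤ, L 0 ≤ a ∧ a ≤ U 0 ∧
      (∀ n, L n ≤ U n) ∧ (∀ n, L (n + 1) ≤ U n) ∧ (∀ n, L n ≤ U (n + 1)) ∧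
      (∀ (n : ℕ) j, L n ≤ j → j ≤ U n → ¬ b (h + n) j) ∧
      (c → ∀ n : ℕ, -U (n + 1) = nextStop (fun j => t (h + n) (-j)) (-U n)) ∧
      (¬ c → ∀ n : ℕ, L (n + 1) = nextStop (fun j => ¬ t (h + n) j) (L n)) := by
    by_cases hc : c
    · set y := flow (fun n j => t (h + n) (-j)) (-a) with hy
      have hle : ∀ n, y n ≤ y (n + 1) := fun n => le_nextStop _ _
      refine ⟨fun n => -y (n + 1), fun n => -y n, ?_, ?_, fun n => neg_le_neg (hle n), fun n => ?_,
        fun n => le_rfl, ?_, ?_, fun h => absurd hc h⟩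
      · have := hle 0
        simp only [hy, flow] at this ⊢
        omega
      · simp [hy, flow]
      · have := hle n
        have := hle (n + 1)
        change -y (n + 1 + 1) ≤ -y n
        omega
      · intro n j h1 h2
        change -y (n + 1) ≤ j at h1
        change j ≤ -y n at h2
        have := flow_mem (s := fun n j => t (h + n) (-j)) (r := fun n j => ¬ b (h + n) (-j))
          (a := -a) ?_ ?_ ?_ (by simpa using ha) n (j := -j) (by change y n ≤ _; omega)
          (by change _ ≤ y (n + 1); omega)
        · simpa using this
        · intro n j h1 h2
          have := H.left _ _ h1 h2
          rwa [show -j - 1 = -(j + 1) by ring] at this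
        · intro n j h1 h2
          have := H.up hc _ _ h1 h2
          rwa [show h + (n : ℤ) + 1 = h + (n + 1 : ℕ) by push_cast; ring] at this
        · intro n a
          obtain ⟨j, hj, ht⟩ := H.exists_left (h + n) (-a)
          exact ⟨-j, by omega, by simpa using ht⟩
      · intro _ n
        simp only [neg_neg]
        rfl
    · set y := flow (fun n j => ¬ t (h + n) j) a with hy
      have hle : ∀ n, y n ≤ y (n + 1) := fun n => le_nextStop _ _
      refine ⟨y, fun n => y (n + 1), le_rfl, hle 0, hle, fun n => le_rfl, fun n => ?_, ?_,
        fun h => absurd h hc, fun _ n => rfl⟩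
      · exact (hle n).trans (hle _)
      · refine fun n j => flow_mem (r := fun n j => ¬ b (h + n) j) ?_ ?_ ?_ (by simpa using ha) n
        · exact fun n j h1 h2 => H.right _ _ h1 (not_not.1 h2)
        · intro n j h1 h2
          have := H.up' hc _ _ h1 h2
          rwa [show h + (n : ℤ) + 1 = h + (n + 1 : ℕ) by push_cast; ring] at this
        · exact fun n a => H.exists_right _ a
  -- In row `h` both halves start at `a`, and the interval is the union of theirs; the flow
  -- equations are therefore claimed only away from this row.
  let lo : ℤ → ℤ := fun k =>
    if h < k then L (k - h).toNat else if k < h then x (h - k).toNat else min (L 0) (x 0)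
  let hi : ℤ → ℤ := fun k =>
    if h < k then U (k - h).toNat else if k < h then x ((h - k).toNat + 1) else max (U 0) (x 1)
  have hup : ∀ n : ℕ, lo (h + (n + 1 : ℕ)) = L (n + 1) ∧ hi (h + (n + 1 : ℕ)) = U (n + 1) := by
    intro n
    simp only [lo, hi]
    rw [if_pos (by omega), if_pos (by omega)]
    simp
  have hdn : ∀ n : ℕ, lo (h - (n + 1 : ℕ)) = x (n + 1) ∧ hi (h - (n + 1 : ℕ)) = x (n + 2) := by
    intro n
    have e1 : ¬ h < h - ((n + 1 : ℕ) : ℤ) := by omega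
    have e2 : h - ((n + 1 : ℕ) : ℤ) < h := by omega
    simp only [lo, hi, if_neg e1, if_pos e2, sub_sub_cancel, Int.toNat_natCast, true_and]
  have hmid : lo h = min (L 0) (x 0) ∧ hi h = max (U 0) (x 1) := by
    simp [lo, hi]
  have cases : ∀ k : ℤ, (∃ n : ℕ, k = h + (n + 1 : ℕ)) ∨ (∃ n : ℕ, k = h - (n + 1 : ℕ)) ∨ k = h := by
    intro k
    rcases lt_trichotomy h k with hk | hk | hk
    · exact Or.inl ⟨(k - h).toNat - 1, by omega⟩
    · exact Or.inr (Or.inr hk.symm)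
    · exact Or.inr (Or.inl ⟨(h - k).toNat - 1, by omega⟩)
  have hx1 : x 0 ≤ x 1 := hxmono 0
  have hLU0 := hLU 0
  refine ⟨lo, hi, ⟨?_, ?_, ?_, ?_, ?_, ?_, ?_⟩, by omega, by omega⟩
  · intro k
    rcases cases k with ⟨n, rfl⟩ | ⟨n, rfl⟩ | rfl
    · rw [(hup n).1, (hup n).2]; exact hLU _
    · rw [(hdn n).1, (hdn n).2]; exact hxmono _
    · omega
  · intro k j h1 h2
    rcases cases k with ⟨n, rfl⟩ | ⟨n, rfl⟩ | rfl
    · rw [(hup n).1] at h1; rw [(hup n).2] at h2; exact hb _ _ h1 h2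
    · rw [(hdn n).1] at h1; rw [(hdn n).2] at h2; exact hxb _ _ h1 h2
    · have h3 := hb 0 j
      have h4 := hxb 0 j
      simp only [Nat.cast_zero, add_zero, sub_zero, zero_add] at h3 h4
      by_cases hj : j ≤ a
      · by_cases hj' : L 0 ≤ j
        · exact h3 hj' (by omega)
        · exact h4 (by omega) (by omega)
      · by_cases hj' : j ≤ U 0
        · exact h3 (by omega) hj'
        · exact h4 (by omega) (by omega)
  · intro k
    rcases cases k with ⟨n, rfl⟩ | ⟨n, rfl⟩ | rfl
    · have := (hup (n + 1)).1
      push_cast at this ⊢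
      rw [show h + ((n : ℤ) + 1) + 1 = h + (n + 1 + 1) by ring, this]
      have h2 := (hup n).2
      push_cast at h2
      rw [h2]
      exact hov _
    · rw [(hdn n).2]
      rcases n with _ | n
      · rw [show h - ((0 + 1 : ℕ) : ℤ) + 1 = h by push_cast; ring]
        have : x 1 ≤ x 2 := hxmono 1
        simp only [zero_add] at this ⊢
        omega
      · rw [show h - ((n + 1 + 1 : ℕ) : ℤ) + 1 = h - (n + 1 : ℕ) by push_cast; ring, (hdn n).1]
        exact (hxmono _).trans (hxmono _)
    · have := (hup 0).1
      have := hov 0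
      simp only [zero_add, Nat.cast_one] at *
      omega
  · intro k
    rcases cases k with ⟨n, rfl⟩ | ⟨n, rfl⟩ | rfl
    · have := (hup (n + 1)).2
      push_cast at this ⊢
      rw [show h + ((n : ℤ) + 1) + 1 = h + (n + 1 + 1) by ring, this]
      have h2 := (hup n).1
      push_cast at h2
      rw [h2]
      exact hov' _
    · rw [(hdn n).1]
      rcases n with _ | n
      · rw [show h - ((0 + 1 : ℕ) : ℤ) + 1 = h by push_cast; ring]
        simp only [zero_add]
        omega
      · rw [show h - ((n + 1 + 1 : ℕ) : ℤ) + 1 = h - (n + 1 : ℕ) by push_cast; ring, (hdn n).2]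
    · have := (hup 0).2
      have := hov' 0
      simp only [zero_add, Nat.cast_one] at *
      omega
  · refine ⟨1 - h, fun k hk => ?_⟩
    obtain ⟨n, rfl⟩ : ∃ n : ℕ, k = n + 1 - h := ⟨(k + h - 1).toNat, by omega⟩
    have h1 := (hdn (n + 1)).1
    have h2 := (hdn n).1
    have h3 := hxs (n + 1)
    push_cast at h1 h2 h3
    simp only
    rw [show -((n : ℤ) + 1 - h + 1) = h - (n + 1 + 1) by ring,
      show -((n : ℤ) + 1 - h) = h - (n + 1) by ring, h1, h2, h3]
  · intro hcc
    refine ⟨h + 1, fun k hk => ?_⟩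
    obtain ⟨n, rfl⟩ : ∃ n : ℕ, k = h + (n + 1) := ⟨(k - h - 1).toNat, by omega⟩
    have h1 := (hup (n + 1)).2
    have h2 := (hup n).2
    have h3 := hc hcc (n + 1)
    push_cast at h1 h2 h3
    simp only
    rw [add_assoc, h1, h2, h3]
  · intro hcc
    refine ⟨h + 1, fun k hk => ?_⟩
    obtain ⟨n, rfl⟩ : ∃ n : ℕ, k = h + (n + 1) := ⟨(k - h - 1).toNat, by omega⟩
    have h1 := (hup (n + 1)).1
    have h2 := (hup n).1
    have h3 := hc' hcc (n + 1)
    push_cast at h1 h2 h3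
    rw [add_assoc, h1, h2, h3]

/-- Nearest neighbours in `b`. -/
def PlaneAdj (b : ℤ → ℤ → Prop) (u v : ℤ × ℤ) : Prop :=
  b v.1 v.2 ∧ ((v.1 = u.1 ∧ (v.2 = u.2 + 1 ∨ v.2 = u.2 - 1)) ∨
    (v.2 = u.2 ∧ (v.1 = u.1 + 1 ∨ v.1 = u.1 - 1)))

namespace IsBarrier

variable {c : Prop} {b t : ℤ → ℤ → Prop} {lo hi lo' hi' : ℤ → ℤ}

theorem left_or_right (H : IsBarrier c b t lo hi) {h j : ℤ} (hb : b h j) : j < lo h ∨ hi h < j := by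
  by_contra! hn
  exact H.disjoint h j hn.1 hn.2 hb

theorem overlap_pred (H : IsBarrier c b t lo hi) (h : ℤ) : lo (h - 1) ≤ hi h := by
  simpa using H.overlap' (h - 1)

theorem overlap_pred' (H : IsBarrier c b t lo hi) (h : ℤ) : lo h ≤ hi (h - 1) := by
  simpa using H.overlap (h - 1)

/-- A horizontal unit step cannot jump over a nonempty interval disjoint from `b`; a vertical step
cannot change sides because the intervals of consecutive rows overlap. -/
theorem left_of_adj (H : IsBarrier c b t lo hi) {u v : ℤ × ℤ} (huv : PlaneAdj b u v)
    (hu : u.2 < lo u.1) : v.2 < lo v.1 := by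
  obtain ⟨u1, u2⟩ := u
  obtain ⟨v1, v2⟩ := v
  obtain ⟨hb, h⟩ := huv
  have := H.le u1
  have := H.overlap u1
  have := H.overlap' u1
  have := H.overlap_pred u1
  have := H.overlap_pred' u1
  have := H.left_or_right hb
  simp only at *
  rcases h with ⟨rfl, rfl | rfl⟩ | ⟨rfl, rfl | rfl⟩ <;> omega

theorem right_of_adj (H : IsBarrier c b t lo hi) {u v : ℤ × ℤ} (huv : PlaneAdj b u v)
    (hu : hi u.1 < u.2) : hi v.1 < v.2 := by
  obtain ⟨u1, u2⟩ := u
  obtain ⟨v1, v2⟩ := v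
  obtain ⟨hb, h⟩ := huv
  have := H.le u1
  have := H.overlap u1
  have := H.overlap' u1
  have := H.overlap_pred u1
  have := H.overlap_pred' u1
  have := H.left_or_right hb
  simp only at *
  rcases h with ⟨rfl, rfl | rfl⟩ | ⟨rfl, rfl | rfl⟩ <;> omega

theorem left_of_reflTransGen (H : IsBarrier c b t lo hi) {u v : ℤ × ℤ}
    (huv : Relation.ReflTransGen (PlaneAdj b) u v) (hu : u.2 < lo u.1) : v.2 < lo v.1 := by
  induction huv with
  | refl => exact hu
  | tail _ h ih => exact H.left_of_adj h ih

theorem right_of_reflTransGen (H : IsBarrier c b t lo hi) {u v : ℤ × ℤ}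
    (huv : Relation.ReflTransGen (PlaneAdj b) u v) (hu : hi u.1 < u.2) : hi v.1 < v.2 := by
  induction huv with
  | refl => exact hu
  | tail _ h ih => exact H.right_of_adj h ih

/-- Far up and far down the two barriers follow the same coalescing flow and so share an endpoint.
Hence no column lies right of the first and left of the second there. -/
theorem exists_le_hi (H : IsBarrier c b t lo hi) (H' : IsBarrier c b t lo' hi')
    (hd : Coalesces fun k j => ¬ t (-k) j) (hu : Coalesces fun k j => t k (-j))
    (hu' : Coalesces fun k j => ¬ t k j) :
    ∃ K, ∀ h, h ≤ -K ∨ K ≤ h → lo' h ≤ hi h := by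
  obtain ⟨k₁, h₁⟩ := H.down.exists_eq hd H'.down
  obtain ⟨k₂, h₂⟩ : ∃ k₂, ∀ h, k₂ ≤ h → lo' h ≤ hi h := by
    by_cases hc : c
    · obtain ⟨k, hk⟩ := (H.up hc).exists_eq hu (H'.up hc)
      refine ⟨k, fun h hh => ?_⟩
      have := hk h hh
      have := H'.le h
      omega
    · obtain ⟨k, hk⟩ := (H.up' hc).exists_eq hu' (H'.up' hc)
      refine ⟨k, fun h hh => ?_⟩
      have := hk h hh
      have := H.le h
      omega
  refine ⟨max k₁ k₂, fun h hh => ?_⟩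
  rcases hh with hh | hh
  · have := h₁ (-h) (by omega)
    simp only [neg_neg] at this
    have := H.le h
    omega
  · exact h₂ h (by omega)

end IsBarrier

/-! ### Horizontal rays in a plane. -/

namespace PlaneRule

variable {c : Prop} {b t : ℤ → ℤ → Prop}

/-- The first site outside `b` to the right of `j` would carry a barrier not lying to the left of
its predecessor. -/
theorem ray_of_right (H : PlaneRule c b t) {h j : ℤ} (hb : b h j)
    (hr : ∀ lo hi, IsBarrier c b t lo hi → hi h < j) (k : ℕ) : b h (j + k) := by
  suffices b h (j + k) ∧ ∀ lo hi, IsBarrier c b t lo hi → hi h < j + k from this.1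
  induction k with
  | zero => simpa using ⟨hb, hr⟩
  | succ k ih =>
    push_cast
    rw [← add_assoc]
    refine ⟨?_, fun lo hi hB => (ih.2 lo hi hB).trans (lt_add_one _)⟩
    by_contra hn
    obtain ⟨lo, hi, hB, -, h2⟩ := H.exists_isBarrier hn
    have h3 := ih.2 lo hi hB
    omega

theorem ray_of_left (H : PlaneRule c b t) {h j : ℤ} (hb : b h j)
    (hr : ∀ lo hi, IsBarrier c b t lo hi → j < lo h) (k : ℕ) : b h (j - k) := by
  suffices b h (j - k) ∧ ∀ lo hi, IsBarrier c b t lo hi → j - k < lo h from this.1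
  induction k with
  | zero => simpa using ⟨hb, hr⟩
  | succ k ih =>
    push_cast
    rw [← sub_sub]
    refine ⟨?_, fun lo hi hB => by have := ih.2 lo hi hB; omega⟩
    by_contra hn
    obtain ⟨lo, hi, hB, h2, -⟩ := H.exists_isBarrier hn
    have h3 := ih.2 lo hi hB
    omega

/-- A right ray in `b` spreads to the neighbours of its end point. -/
theorem ray_right_of_adj (H : PlaneRule c b t) {u v : ℤ × ℤ}
    (hu : ∀ k : ℕ, b u.1 (u.2 + k)) (huv : PlaneAdj b u v) (k : ℕ) : b v.1 (v.2 + k) := by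
  refine H.ray_of_right huv.1 (fun lo hi hB => hB.right_of_adj huv ?_) k
  -- A barrier to the right of `u` would confine the whole ray to the left of `lo u.1`.
  refine (hB.left_or_right (by simpa using hu 0)).resolve_left fun hl => ?_
  have h1 : ∀ k : ℕ, u.2 + k < lo u.1 := by
    intro k
    induction k with
    | zero => simpa using hl
    | succ k ih =>
      exact hB.left_of_adj (u := (u.1, u.2 + k)) (v := (u.1, u.2 + (k + 1 : ℕ)))
        ⟨hu _, Or.inl ⟨rfl, Or.inl (by push_cast; ring)⟩⟩ ih
  have := h1 (lo u.1 - u.2).toNat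
  omega

/-- A left ray in `b` spreads to the neighbours of its end point. -/
theorem ray_left_of_adj (H : PlaneRule c b t) {u v : ℤ × ℤ}
    (hu : ∀ k : ℕ, b u.1 (u.2 - k)) (huv : PlaneAdj b u v) (k : ℕ) : b v.1 (v.2 - k) := by
  refine H.ray_of_left huv.1 (fun lo hi hB => hB.left_of_adj huv ?_) k
  refine (hB.left_or_right (by simpa using hu 0)).resolve_right fun hl => ?_
  have h1 : ∀ k : ℕ, hi u.1 < u.2 - k := by
    intro k
    induction k with
    | zero => simpa using hl
    | succ k ih =>
      exact hB.right_of_adj (u := (u.1, u.2 - k)) (v := (u.1, u.2 - (k + 1 : ℕ)))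
        ⟨hu _, Or.inl ⟨rfl, Or.inr (by push_cast; ring)⟩⟩ ih
  have := h1 (u.2 - hi u.1).toNat
  omega

/-- An infinite connected subset of `b` contains a ray. -/
theorem exists_ray (H : PlaneRule c b t)
    (hd : Coalesces fun k j => ¬ t (-k) j) (hu : Coalesces fun k j => t k (-j))
    (hu' : Coalesces fun k j => ¬ t k j) {C : Set (ℤ × ℤ)} (hC : C.Infinite)
    (hb : ∀ u ∈ C, b u.1 u.2)
    (hconn : ∀ u ∈ C, ∀ v ∈ C, Relation.ReflTransGen (PlaneAdj b) u v) :
    ∃ u : ℤ × ℤ, (∀ k : ℕ, b u.1 (u.2 + k)) ∨ ∀ k : ℕ, b u.1 (u.2 - k) := by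
  obtain ⟨u, huC⟩ := hC.nonempty
  refine ⟨u, ?_⟩
  by_cases hr : ∀ lo hi, IsBarrier c b t lo hi → hi u.1 < u.2
  · exact Or.inl (H.ray_of_right (hb u huC) hr)
  refine Or.inr (H.ray_of_left (hb u huC) fun lo hi hB => ?_)
  push Not at hr
  obtain ⟨lo', hi', hB', hle⟩ := hr
  have hl' := (hB'.left_or_right (hb u huC)).resolve_right hle.not_gt
  -- With barriers on both sides of `u`, the set `C` is trapped between them: finitely many rows,
  -- and finitely many columns in each.
  refine (hB.left_or_right (hb u huC)).resolve_right fun hr => hC ?_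
  obtain ⟨K, hK⟩ := hB.exists_le_hi hB' hd hu hu'
  refine ((Set.finite_Icc (-K) K).biUnion fun h _ =>
    (Set.finite_Ioo (hi h) (lo' h)).image (Prod.mk h)).subset fun v hv => ?_
  have h1 := hB.right_of_reflTransGen (hconn u huC v hv) hr
  have h2 := hB'.left_of_reflTransGen (hconn u huC v hv) hl'
  have h3 := hK v.1
  simp only [Set.mem_iUnion]
  exact ⟨v.1, ⟨by omega, by omega⟩, v.2, ⟨h1, h2⟩, rfl⟩

end PlaneRule

end DRE

/-! ### Backward clusters and planes of the lattice. -/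

namespace DRE

variable {d : ℕ}

theorem single_mem_units (m : Fin d) : (Pi.single m 1 : Site d) ∈ units d := Or.inl ⟨m, rfl⟩

theorem neg_single_mem_units (m : Fin d) : (-Pi.single m 1 : Site d) ∈ units d := Or.inr ⟨m, rfl⟩

theorem neg_mem_units {e : Site d} (he : e ∈ units d) : -e ∈ units d := by
  rcases he with ⟨m, rfl⟩ | ⟨m, rfl⟩
  · exact neg_single_mem_units m
  · simpa using single_mem_units m

/-- The vectors `v` such that translation by `v` and by `-v` maps `S` into itself form a subgroup,
and it contains the generators `Pi.single m 1`. -/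
theorem eq_univ_of_closed {S : Set (Site d)} (hne : S.Nonempty)
    (hS : ∀ x ∈ S, ∀ m : Fin d, x + Pi.single m 1 ∈ S ∧ x - Pi.single m 1 ∈ S) :
    S = Set.univ := by
  let H : AddSubgroup (Site d) :=
    { carrier := {v | ∀ x ∈ S, x + v ∈ S ∧ x - v ∈ S}
      zero_mem' := fun x hx => by simpa using hx
      add_mem' := fun {u v} hu hv x hx => by
        rw [← add_assoc, ← sub_sub]
        exact ⟨(hv _ (hu x hx).1).1, (hv _ (hu x hx).2).2⟩
      neg_mem' := fun {u} hu x hx => by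
        rw [sub_neg_eq_add, ← sub_eq_add_neg]
        exact (hu x hx).symm }
  have hH : ∀ v, v ∈ H := by
    intro v
    rw [← Finset.univ_sum_single v]
    refine sum_mem fun m _ => ?_
    have : (Pi.single m (v m) : Site d) = v m • Pi.single m 1 := by
      rw [← Pi.single_smul]; simp
    rw [this]
    exact zsmul_mem (show Pi.single m 1 ∈ H from fun x hx => hS x hx m) _
  obtain ⟨x, hx⟩ := hne
  refine Set.eq_univ_of_forall fun y => ?_
  have := (hH (y - x) x hx).1
  rwa [add_sub_cancel] at this

theorem mem_backwardCluster_of_step {G : Site d → Set (Site d)} {o x e : Site d} (he : e ∈ G x)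
    (hx : x + e ∈ backwardCluster G o) : x ∈ backwardCluster G o :=
  Relation.ReflTransGen.head ⟨e, he, rfl⟩ hx

theorem self_mem_backwardCluster (G : Site d → Set (Site d)) (o : Site d) :
    o ∈ backwardCluster G o := Relation.ReflTransGen.refl

theorem backwardCluster_mono {G G' : Site d → Set (Site d)} (h : ∀ x, G x ⊆ G' x) (o : Site d) :
    backwardCluster G o ⊆ backwardCluster G' o :=
  fun _ hx => Relation.ReflTransGen.mono (fun _ _ ⟨e, he, hb⟩ => ⟨e, h _ he, hb⟩) _ _ hx

/-- The backward cluster is connected through nearest neighbours. -/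
theorem backwardCluster_subset_of_closed {G : Site d → Set (Site d)} (hG : ∀ x, G x ⊆ units d)
    {o : Site d} {S : Set (Site d)} {x₀ : Site d} (h₀ : x₀ ∈ S) (h₀' : x₀ ∈ backwardCluster G o)
    (hS : ∀ x ∈ S, ∀ y ∈ backwardCluster G o, y - x ∈ units d → y ∈ S) :
    backwardCluster G o ⊆ S := by
  -- The path from `x₀` to `o` stays in the cluster; from `o`, every other site of the cluster is
  -- reached by reversing its own path.
  have ho : o ∈ S := by
    change Relation.ReflTransGen (fun a b => ∃ e ∈ G a, b = a + e) x₀ o at h₀'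
    induction h₀' using Relation.ReflTransGen.head_induction_on with
    | refl => exact h₀
    | @head a c hac hco ih =>
      obtain ⟨e, he, rfl⟩ := hac
      exact ih (hS a h₀ _ hco (by simpa using hG a he))
  intro y hy
  change Relation.ReflTransGen (fun a b => ∃ e ∈ G a, b = a + e) y o at hy
  induction hy using Relation.ReflTransGen.head_induction_on with
  | refl => exact ho
  | @head a c hac hco ih =>
    obtain ⟨e, he, rfl⟩ := hac
    refine hS _ ih a (mem_backwardCluster_of_step he hco) ?_
    simpa using neg_mem_units (hG a he)

variable [NeZero d]

/-- The site of the plane through `z` in directions `1, i` with `i`-th coordinate `h` and first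
coordinate `j`. -/
def planePt (i : Fin d) (z : Site d) (h j : ℤ) : Site d :=
  Function.update (Function.update z 0 j) i h

theorem planePt_eq {i : Fin d} (hi : i ≠ 0) {x z : Site d} (hx : x ∈ plane i z) :
    planePt i z (x i) (x 0) = x := by
  ext m
  by_cases hm : m = i
  · subst hm; simp [planePt]
  · by_cases hm0 : m = 0
    · subst hm0; simp [planePt, hm]
    · simp [planePt, hm, hm0, hx m hm0 hm]

theorem planePt_add_col {i : Fin d} (hi : i ≠ 0) (z : Site d) (h j n : ℤ) :
    planePt i z h (j + n) = planePt i z h j + n • e₁ d := by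
  ext m
  by_cases hm : m = i
  · subst hm; simp [planePt, e₁, hi]
  · by_cases hm0 : m = 0
    · subst hm0; simp [planePt, e₁, hm]
    · simp [planePt, e₁, hm, hm0]

theorem planePt_add_row (i : Fin d) (z : Site d) (h j n : ℤ) :
    planePt i z (h + n) j = planePt i z h j + n • Pi.single i 1 := by
  ext m
  by_cases hm : m = i
  · subst hm; simp [planePt]
  · simp [planePt, hm]

/-- Neighbouring sites of a plane, in plane coordinates. -/
theorem planeAdj_of_mem {i : Fin d} (hi : i ≠ 0) {B : Set (Site d)} {x y z : Site d}
    (hx : x ∈ plane i z) (hy : y ∈ plane i z) (hyB : y ∈ B) (hxy : y - x ∈ units d) :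
    PlaneAdj (fun h j => planePt i z h j ∈ B) (x i, x 0) (y i, y 0) := by
  refine ⟨by simpa only [planePt_eq hi hy] using hyB, ?_⟩
  have key : ∀ (m : Fin d) (ε : ℤ), ε ≠ 0 → y = x + ε • Pi.single m 1 → m = 0 ∨ m = i := by
    intro m ε hε h
    by_contra! hm
    have h1 := hx m hm.1 hm.2
    have h2 := hy m hm.1 hm.2
    rw [h] at h2
    simp [h1, hε] at h2
  rcases hxy with ⟨m, hm⟩ | ⟨m, hm⟩
  · have h : y = x + (1 : ℤ) • Pi.single m 1 := by rw [one_zsmul, ← hm]; abel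
    rcases key m 1 (by simp) h with rfl | rfl
    · exact Or.inl (by simp [h, hi])
    · exact Or.inr (by simp [h, hi.symm])
  · have h : y = x + (-1 : ℤ) • Pi.single m 1 := by rw [neg_one_zsmul, ← hm]; abel
    rcases key m (-1) (by simp) h with rfl | rfl
    · exact Or.inl (by simp [h, hi, sub_eq_add_neg])
    · exact Or.inr (by simp [h, hi.symm, sub_eq_add_neg])

/-! ### The deterministic trichotomy. -/

/-- What the environment `G` offers: `T` tells the type of a site, and `M` is the set of directions
available at all sites of the first type. -/
structure Offers (M : Set (Fin d)) (T : Site d → Prop) (G : Site d → Set (Site d)) : Prop where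
  zero_mem : (0 : Fin d) ∈ M
  subset_units : ∀ x, G x ⊆ units d
  pos : ∀ x, T x → ∀ m ∈ M, Pi.single m 1 ∈ G x
  neg : ∀ x, ¬ T x → ∀ m, -Pi.single m 1 ∈ G x
  pos' : ∀ x, ¬ T x → ∀ m, m ∉ M → Pi.single m 1 ∈ G x

/-- Both types occur on all half-lines in the first direction, and the paths in all planes
coalesce. -/
structure Regular (T : Site d → Prop) : Prop where
  exists_left : ∀ x, ∃ k : ℕ, T (x - k • e₁ d)
  exists_right : ∀ x, ∃ k : ℕ, ¬ T (x + k • e₁ d)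
  exists_right' : ∀ x, ∃ k : ℕ, T (x + k • e₁ d)
  coalesces_down : ∀ i ≠ 0, ∀ z, Coalesces fun k j => ¬ T (planePt i z (-k) j)
  coalesces_up : ∀ i ≠ 0, ∀ z, Coalesces fun k j => T (planePt i z k (-j))
  coalesces_up' : ∀ i ≠ 0, ∀ z, Coalesces fun k j => ¬ T (planePt i z k j)

section

variable {M : Set (Fin d)} {T : Site d → Prop} {G : Site d → Set (Site d)}

theorem Offers.planeRule (H : Offers M T G) (R : Regular T) (o : Site d) {i : Fin d} (hi : i ≠ 0)
    (z : Site d) :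
    PlaneRule (i ∈ M) (fun h j => planePt i z h j ∈ backwardCluster G o)
      (fun h j => T (planePt i z h j)) where
  right h j hb ht hn := by
    rw [planePt_add_col hi, one_zsmul] at hn
    exact hb (mem_backwardCluster_of_step (H.pos _ ht _ H.zero_mem) hn)
  left h j hb ht hn := by
    rw [sub_eq_add_neg, planePt_add_col hi, neg_one_zsmul] at hn
    exact hb (mem_backwardCluster_of_step (H.neg _ ht 0) hn)
  down h j hb ht hn := by
    rw [sub_eq_add_neg, planePt_add_row, neg_one_zsmul] at hn
    exact hb (mem_backwardCluster_of_step (H.neg _ ht i) hn)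
  up hi h j hb ht hn := by
    rw [planePt_add_row, one_zsmul] at hn
    exact hb (mem_backwardCluster_of_step (H.pos _ ht i hi) hn)
  up' hi h j hb ht hn := by
    rw [planePt_add_row, one_zsmul] at hn
    exact hb (mem_backwardCluster_of_step (H.pos' _ ht i hi) hn)
  exists_left h a := by
    obtain ⟨k, hk⟩ := R.exists_left (planePt i z h a)
    refine ⟨a - k, by omega, ?_⟩
    rwa [sub_eq_add_neg, planePt_add_col hi, neg_smul, natCast_zsmul, ← sub_eq_add_neg]
  exists_right h a := by
    obtain ⟨k, hk⟩ := R.exists_right (planePt i z h a)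
    refine ⟨a + k, by omega, ?_⟩
    rwa [planePt_add_col hi, natCast_zsmul]

theorem mem_plane_self (i : Fin d) (x : Site d) : x ∈ plane i x := fun _ _ _ => rfl

theorem exists_plane_of_sub_mem_units (hd : 2 ≤ d) {x y : Site d} (hxy : y - x ∈ units d) :
    ∃ i : Fin d, i ≠ 0 ∧ y ∈ plane i x := by
  have key : ∀ m : Fin d, ∃ i : Fin d, i ≠ 0 ∧ (m = 0 ∨ m = i) := by
    intro m
    by_cases hm : m = 0
    · exact ⟨⟨1, hd⟩, by simp [Fin.ext_iff], Or.inl hm⟩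
    · exact ⟨m, hm, Or.inr rfl⟩
  have key2 : ∀ (m : Fin d) (ε : ℤ), y = x + ε • Pi.single m 1 →
      ∃ i : Fin d, i ≠ 0 ∧ y ∈ plane i x := by
    intro m ε h
    obtain ⟨i, hi, hm⟩ := key m
    refine ⟨i, hi, fun k hk0 hki => ?_⟩
    have : k ≠ m := by rcases hm with rfl | rfl <;> assumption
    simp [h, this]
  rcases hxy with ⟨m, hm⟩ | ⟨m, hm⟩
  · exact key2 m 1 (by rw [one_zsmul, ← hm]; abel)
  · exact key2 m (-1) (by rw [neg_one_zsmul, ← hm]; abel)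

/-- If the backward cluster contains a right ray then it is a union of right rays. -/
theorem Offers.right_closed_of_ray (H : Offers M T G) (R : Regular T) (hd : 2 ≤ d) {o x₀ : Site d}
    (hx₀ : ∀ k : ℕ, x₀ + k • e₁ d ∈ backwardCluster G o) :
    ∀ x ∈ backwardCluster G o, x + e₁ d ∈ backwardCluster G o := by
  have hsub := backwardCluster_subset_of_closed H.subset_units (o := o)
    (S := {x | ∀ k : ℕ, x + k • e₁ d ∈ backwardCluster G o}) (x₀ := x₀) hx₀
    (by simpa using hx₀ 0) ?_
  · exact fun x hx => by simpa using hsub hx 1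
  · intro x hx y hy hxy k
    -- Two neighbours lie in a common plane, so the planar spreading of rays carries over to the
    -- lattice.
    obtain ⟨i, hi, hyx⟩ := exists_plane_of_sub_mem_units hd hxy
    have := (H.planeRule R o hi x).ray_right_of_adj (u := (x i, x 0)) (v := (y i, y 0)) ?_
      (planeAdj_of_mem hi (mem_plane_self i x) hyx hy hxy) k
    · simpa only [planePt_add_col hi, planePt_eq hi hyx, natCast_zsmul] using this
    · intro k
      simpa only [planePt_add_col hi, planePt_eq hi (mem_plane_self i x), natCast_zsmul] using hx k

/-- If the backward cluster contains a left ray then it is a union of left rays. -/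
theorem Offers.left_closed_of_ray (H : Offers M T G) (R : Regular T) (hd : 2 ≤ d) {o x₀ : Site d}
    (hx₀ : ∀ k : ℕ, x₀ - k • e₁ d ∈ backwardCluster G o) :
    ∀ x ∈ backwardCluster G o, x - e₁ d ∈ backwardCluster G o := by
  have hsub := backwardCluster_subset_of_closed H.subset_units (o := o)
    (S := {x | ∀ k : ℕ, x - k • e₁ d ∈ backwardCluster G o}) (x₀ := x₀) hx₀
    (by simpa using hx₀ 0) ?_
  · exact fun x hx => by simpa using hsub hx 1
  · intro x hx y hy hxy k
    obtain ⟨i, hi, hyx⟩ := exists_plane_of_sub_mem_units hd hxy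
    have := (H.planeRule R o hi x).ray_left_of_adj (u := (x i, x 0)) (v := (y i, y 0)) ?_
      (planeAdj_of_mem hi (mem_plane_self i x) hyx hy hxy) k
    · simpa only [sub_eq_add_neg, planePt_add_col hi, planePt_eq hi hyx, neg_smul,
        natCast_zsmul] using this
    · intro k
      simpa only [sub_eq_add_neg, planePt_add_col hi, planePt_eq hi (mem_plane_self i x), neg_smul,
        natCast_zsmul] using hx k

theorem Offers.exists_ray_of_not_semiFinite (H : Offers M T G) (R : Regular T) {o : Site d}
    (hs : ¬ SemiFinite (backwardCluster G o)) :
    ∃ x : Site d, (∀ k : ℕ, x + k • e₁ d ∈ backwardCluster G o) ∨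
      ∀ k : ℕ, x - k • e₁ d ∈ backwardCluster G o := by
  simp only [SemiFinite, not_forall] at hs
  obtain ⟨i, hi, z, c, hc⟩ := hs
  let f : ↥(plane i z ∩ backwardCluster G o) → ℤ × ℤ := fun x => (x.1 i, x.1 0)
  have hf : Function.Injective f := by
    intro x y hxy
    simp only [f, Prod.mk.injEq] at hxy
    refine Subtype.ext ?_
    rw [← planePt_eq hi x.2.1, ← planePt_eq hi y.2.1, hxy.1, hxy.2]
  have hmem : ∀ u ∈ f '' c.supp, planePt i z u.1 u.2 ∈ backwardCluster G o := by
    rintro _ ⟨x, -, rfl⟩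
    simpa only [f, planePt_eq hi x.2.1] using x.2.2
  have hconn : ∀ u ∈ f '' c.supp, ∀ v ∈ f '' c.supp, Relation.ReflTransGen
      (PlaneAdj fun h j => planePt i z h j ∈ backwardCluster G o) u v := by
    rintro _ ⟨x, hx, rfl⟩ _ ⟨y, hy, rfl⟩
    have hxy : ((latticeGraph d).induce (plane i z ∩ backwardCluster G o)).Reachable x y :=
      SimpleGraph.ConnectedComponent.exact (hx.trans hy.symm)
    rw [SimpleGraph.reachable_iff_reflTransGen] at hxy
    refine hxy.lift f fun a b hab => planeAdj_of_mem hi a.2.1 b.2.1 b.2.2 ?_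
    have h : a.1 ≠ b.1 ∧ (b.1 - a.1 ∈ units d ∨ a.1 - b.1 ∈ units d) := hab
    rcases h.2 with h | h
    · exact h
    · simpa using neg_mem_units h
  obtain ⟨u, hu⟩ := (H.planeRule R o hi z).exists_ray (R.coalesces_down i hi z)
    (R.coalesces_up i hi z) (R.coalesces_up' i hi z) (Set.Infinite.image hf.injOn hc) hmem hconn
  refine ⟨planePt i z u.1 u.2, hu.imp (fun h k => ?_) fun h k => ?_⟩
  · simpa only [planePt_add_col hi, natCast_zsmul] using h k
  · simpa only [sub_eq_add_neg, planePt_add_col hi, neg_smul, natCast_zsmul] using h k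

/-- The environment in which all unit vectors are added at the sites of the second type. -/
structure IsEnrichment (T : Site d → Prop) (G G' : Site d → Set (Site d)) : Prop where
  eq : ∀ x, T x → G' x = G x
  eq_units : ∀ x, ¬ T x → G' x = units d

variable {G' : Site d → Set (Site d)}

theorem IsEnrichment.subset (H' : IsEnrichment T G G') (H : Offers M T G) (x : Site d) :
    G x ⊆ G' x := by
  by_cases hx : T x
  · rw [H'.eq x hx]
  · rw [H'.eq_units x hx]; exact H.subset_units x

/-- A site of the second type at which the backward cluster is smaller than the one of the enriched
environment. -/
theorem IsEnrichment.exists_of_ne (H' : IsEnrichment T G G') (H : Offers M T G) {o : Site d}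
    (hne : backwardCluster G o ≠ backwardCluster G' o) :
    ∃ y ∉ backwardCluster G o, ¬ T y ∧ ∃ m ∈ M, y + Pi.single m 1 ∈ backwardCluster G o := by
  by_contra! hcon
  refine hne (Set.Subset.antisymm (backwardCluster_mono (H'.subset H) o) fun x hx => ?_)
  change Relation.ReflTransGen (fun a b => ∃ e ∈ G' a, b = a + e) x o at hx
  induction hx using Relation.ReflTransGen.head_induction_on with
  | refl => exact self_mem_backwardCluster G o
  | @head a c hac _ ih =>
    obtain ⟨e, he, rfl⟩ := hac
    by_contra ha
    have hnot : e ∉ G a := fun h => ha (mem_backwardCluster_of_step h ih)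
    by_cases hT : T a
    · rw [H'.eq a hT] at he
      exact hnot he
    · rw [H'.eq_units a hT] at he
      -- The only arrows that enrichment can really add are the positive ones in directions of `M`.
      rcases he with ⟨m, rfl⟩ | ⟨m, rfl⟩
      · by_cases hm : m ∈ M
        · exact hcon a ha hT m hm ih
        · exact hnot (H.pos' a hT m hm)
      · exact hnot (H.neg a hT m)

/-- Otherwise some `y` outside the cluster has `y + Pi.single m 1` inside, with `m ∈ M`, and the
left ray of the latter is inside too. Going left from `y`, a site of the second type passes
non-membership on through its arrow `-e₁ d`, while one of the first type would step into that ray;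
but the first type does occur. -/
theorem IsEnrichment.eq_of_left_closed (H' : IsEnrichment T G G') (H : Offers M T G)
    (R : Regular T) {o : Site d}
    (hl : ∀ x ∈ backwardCluster G o, x - e₁ d ∈ backwardCluster G o) :
    backwardCluster G o = backwardCluster G' o := by
  by_contra hne
  obtain ⟨y, hy, hT, m, hm, hym⟩ := H'.exists_of_ne H hne
  have hray : ∀ k : ℕ, y - k • e₁ d + Pi.single m 1 ∈ backwardCluster G o := by
    intro k
    induction k with
    | zero => simpa using hym
    | succ k ih =>
      have := hl _ ih
      rwa [show y - (k + 1) • e₁ d + Pi.single m 1 = y - k • e₁ d + Pi.single m 1 - e₁ d by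
        rw [succ_nsmul]; abel]
  have hout : ∀ k : ℕ, y - k • e₁ d ∉ backwardCluster G o := by
    intro k
    induction k with
    | zero => simpa using hy
    | succ k ih =>
      have hTk : ¬ T (y - k • e₁ d) := fun h =>
        ih (mem_backwardCluster_of_step (H.pos _ h m hm) (hray k))
      intro hmem
      refine ih (mem_backwardCluster_of_step (H.neg _ hTk 0) ?_)
      rwa [show y - k • e₁ d + -Pi.single 0 1 = y - (k + 1) • e₁ d by
        rw [succ_nsmul, e₁]; abel]
  obtain ⟨k, hk⟩ := R.exists_left y
  exact hout k (mem_backwardCluster_of_step (H.pos _ hk m hm) (hray k))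

theorem onePlus_eq_of_right_closed {B : Set (Site d)} (hr : ∀ x ∈ B, x + e₁ d ∈ B) :
    B = onePlus B := by
  refine Set.Subset.antisymm (fun x hx => ?_) fun x hx => ?_
  · exact Set.mem_biUnion hx ⟨0, by simp⟩
  · obtain ⟨z, hz, k, rfl⟩ := Set.mem_iUnion₂.1 hx
    induction k with
    | zero => simpa using hz
    | succ k ih =>
      rw [succ_nsmul, ← add_assoc]
      exact hr _ (ih (Set.mem_biUnion hz ⟨k, rfl⟩))

theorem eq_or_of_right_closed {B B' : Set (Site d)} (hr : ∀ x ∈ B, x + e₁ d ∈ B)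
    (hB' : B' = Set.univ) :
    B = B' ∨ (B = onePlus B ∧ B ≠ Set.univ ∧ B' = Set.univ) := by
  by_cases h : B = Set.univ
  · exact Or.inl (h.trans hB'.symm)
  · exact Or.inr ⟨onePlus_eq_of_right_closed hr, h, hB'⟩

/-- Every enriched site has the arrow `e₁ d`, so a site missing from the enriched cluster gives a
whole horizontal line missing the original one. Then each neighbouring line misses it as well:
otherwise it would contain a right ray, reached by an arrow from far enough to the right on the
first line. Finally even `o` would be missing. -/
theorem IsEnrichment.eq_univ_of_right_closed (H' : IsEnrichment T G G') (H : Offers M T G)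
    (R : Regular T) {o : Site d}
    (hr : ∀ x ∈ backwardCluster G o, x + e₁ d ∈ backwardCluster G o) :
    backwardCluster G' o = Set.univ := by
  by_contra hne
  obtain ⟨x, hx⟩ := (Set.ne_univ_iff_exists_notMem _).1 hne
  have hsub := backwardCluster_mono (H'.subset H) o
  have hrk : ∀ w ∈ backwardCluster G o, ∀ k : ℕ, w + k • e₁ d ∈ backwardCluster G o := by
    intro w hw k
    induction k with
    | zero => simpa using hw
    | succ k ih =>
      rw [succ_nsmul, ← add_assoc]
      exact hr _ ih
  have hright : ∀ k : ℕ, x + k • e₁ d ∉ backwardCluster G' o := by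
    intro k
    induction k with
    | zero => simpa using hx
    | succ k ih =>
      rw [succ_nsmul, ← add_assoc]
      refine fun h => ih (mem_backwardCluster_of_step ?_ h)
      by_cases hT : T (x + k • e₁ d)
      · rw [H'.eq _ hT]; exact H.pos _ hT _ H.zero_mem
      · rw [H'.eq_units _ hT]; exact single_mem_units 0
  have hline : ∀ n : ℤ, x + n • e₁ d ∉ backwardCluster G o := by
    intro n hn
    refine hright n.toNat (hsub ?_)
    have := hrk _ hn (n.toNat - n).toNat
    rwa [← natCast_zsmul, add_assoc, ← add_smul,
      show n + ((n.toNat - n).toNat : ℤ) = (n.toNat : ℤ) by omega, natCast_zsmul] at this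
  have hall := eq_univ_of_closed (S := {x | ∀ n : ℤ, x + n • e₁ d ∉ backwardCluster G o})
    ⟨x, hline⟩ ?_
  · have : o ∈ {x | ∀ n : ℤ, x + n • e₁ d ∉ backwardCluster G o} := hall ▸ Set.mem_univ o
    exact this 0 (by simpa using self_mem_backwardCluster G o)
  intro w hw m
  have hout : ∀ v : Site d, (∀ n : ℤ, ∃ k : ℕ, v - w ∈ G (w + n • e₁ d + k • e₁ d)) →
      ∀ n : ℤ, v + n • e₁ d ∉ backwardCluster G o := by
    intro v hv n hn
    obtain ⟨k, hk⟩ := hv n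
    refine hw (n + k) ?_
    rw [add_smul, natCast_zsmul, ← add_assoc]
    refine mem_backwardCluster_of_step hk ?_
    rw [show w + n • e₁ d + k • e₁ d + (v - w) = v + n • e₁ d + k • e₁ d by abel]
    exact hrk _ hn k
  refine ⟨hout _ fun n => ?_, hout _ fun n => ?_⟩
  · rw [add_sub_cancel_left]
    by_cases hm : m ∈ M
    · obtain ⟨k, hk⟩ := R.exists_right' (w + n • e₁ d)
      exact ⟨k, H.pos _ hk m hm⟩
    · obtain ⟨k, hk⟩ := R.exists_right (w + n • e₁ d)
      exact ⟨k, H.pos' _ hk m hm⟩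
  · rw [sub_sub_cancel_left]
    obtain ⟨k, hk⟩ := R.exists_right (w + n • e₁ d)
    exact ⟨k, H.neg _ hk m⟩

/-- The deterministic part of the theorem. -/
theorem IsEnrichment.semiFinite_or (H' : IsEnrichment T G G') (H : Offers M T G)
    (R : Regular T) (hd : 2 ≤ d) (o : Site d) :
    SemiFinite (backwardCluster G o) ∨ backwardCluster G o = backwardCluster G' o ∨
      (backwardCluster G o = onePlus (backwardCluster G o) ∧ backwardCluster G o ≠ Set.univ ∧
        backwardCluster G' o = Set.univ) := by
  by_cases hs : SemiFinite (backwardCluster G o)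
  · exact Or.inl hs
  refine Or.inr ?_
  obtain ⟨x, hx | hx⟩ := H.exists_ray_of_not_semiFinite R hs
  · have hr := H.right_closed_of_ray R hd hx
    exact eq_or_of_right_closed hr (H'.eq_univ_of_right_closed H R hr)
  · exact Or.inl (H'.eq_of_left_closed H R (H.left_closed_of_ray R hd hx))

/-- The case `p = 0`: the arrows `-e₁ d` are present everywhere, so the cluster is closed to the
right. -/
theorem IsEnrichment.eq_or_of_forall_not (H' : IsEnrichment T G G') (H : Offers M T G)
    (hT : ∀ x, ¬ T x) (o : Site d) :
    backwardCluster G o = backwardCluster G' o ∨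
      (backwardCluster G o = onePlus (backwardCluster G o) ∧ backwardCluster G o ≠ Set.univ ∧
        backwardCluster G' o = Set.univ) := by
  refine eq_or_of_right_closed (fun x hx => ?_) ?_
  · refine mem_backwardCluster_of_step (H.neg _ (hT _) 0) ?_
    simpa [e₁] using hx
  · refine eq_univ_of_closed ⟨o, self_mem_backwardCluster G' o⟩ fun x hx m => ⟨?_, ?_⟩
    · refine mem_backwardCluster_of_step (e := -Pi.single m 1) ?_ (by simpa using hx)
      rw [H'.eq_units _ (hT _)]
      exact neg_single_mem_units m
    · refine mem_backwardCluster_of_step (e := Pi.single m 1) ?_ (by simpa using hx)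
      rw [H'.eq_units _ (hT _)]
      exact single_mem_units m

end

end DRE

/-! ### From the random labels to the deterministic hypotheses. -/

namespace DRE

theorem exists_mem_cell {k : ℕ} {r : Fin k → ℝ} (hr : r ∈ stdSimplex ℝ (Fin k)) {u : ℝ}
    (hu : u ∈ Set.Ico (0 : ℝ) 1) : ∃ i, u ∈ cell r i := by
  classical
  let S : ℕ → ℝ := fun n => ∑ j with j.val < n, r j
  have hk : u < S k := by
    have : S k = 1 := by
      rw [← hr.2]
      exact Finset.sum_congr (Finset.filter_true_of_mem fun j _ => j.2) fun _ _ => rfl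
    exact this ▸ hu.2
  have hex : ∃ n, u < S n := ⟨k, hk⟩
  have hle : Nat.find hex ≤ k := Nat.find_min' hex hk
  have hpos : 0 < Nat.find hex := by
    refine Nat.pos_of_ne_zero fun h0 => ?_
    have h := Nat.find_spec hex
    rw [h0] at h
    simp only [S, Nat.not_lt_zero, Finset.filter_false, Finset.sum_empty] at h
    exact h.not_ge hu.1
  have hlow : S (Nat.find hex - 1) ≤ u := not_lt.1 (Nat.find_min hex (by omega))
  refine ⟨⟨Nat.find hex - 1, by omega⟩, ?_, ?_⟩
  · refine le_of_eq_of_le (Finset.sum_congr ?_ fun _ _ => rfl) hlow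
    ext j
    simp [Fin.lt_def]
  · refine lt_of_lt_of_eq (Nat.find_spec hex) (Finset.sum_congr ?_ fun _ _ => rfl)
    ext j
    simp only [Finset.mem_filter, Finset.mem_univ, true_and, Finset.mem_Iic, Fin.le_def]
    omega

section Environment

variable {d k l : ℕ} {E : Fin k → Set (Site d)} {F : Fin l → Set (Site d)}
  {r : Fin k → ℝ} {q : Fin l → ℝ} {p : ℝ} {u u' : Site d → ℝ}

theorem ModelCondition.offers [NeZero d] (hcond : ModelCondition E F) (hE : ∀ i, E i ⊆ units d)
    (hF : ∀ j, F j ⊆ units d) (hr : r ∈ stdSimplex ℝ (Fin k)) (hq : q ∈ stdSimplex ℝ (Fin l))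
    (hu' : ∀ x, u' x ∈ Set.Ico (0 : ℝ) 1) :
    Offers {m | Pi.single m 1 ∈ ⋂ i, E i} (fun x => u x < p) (env E F r q p u u') where
  zero_mem := hcond.e₁_mem
  subset_units x := by
    rintro e (⟨-, i, -, he⟩ | ⟨-, i, -, he⟩)
    · exact hE i he
    · exact hF i he
  pos x hx m hm := by
    obtain ⟨i, hi⟩ := exists_mem_cell hr (hu' x)
    exact Or.inl ⟨hx, i, hi, Set.mem_iInter.1 hm i⟩
  neg x hx m := by
    obtain ⟨j, hj⟩ := exists_mem_cell hq (hu' x)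
    refine Or.inr ⟨not_lt.1 hx, j, hj, Set.mem_iInter.1 (hcond.diff_subset
      ⟨neg_single_mem_units m, fun hmem => ?_⟩) j⟩
    -- Some index is needed, since an empty intersection would be everything.
    obtain ⟨i, -⟩ := exists_mem_cell hr (hu' x)
    obtain ⟨m', hm'⟩ := hcond.iUnion_subset (Set.mem_iUnion.2 ⟨i, Set.mem_iInter.1 hmem i⟩)
    have h1 := congrFun hm' m
    by_cases h : m = m'
    · subst h; simp at h1
    · simp [h] at h1
  pos' x hx m hm := by
    obtain ⟨j, hj⟩ := exists_mem_cell hq (hu' x)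
    exact Or.inr ⟨not_lt.1 hx, j, hj, Set.mem_iInter.1 (hcond.diff_subset
      ⟨single_mem_units m, hm⟩) j⟩

theorem isEnrichment_env (hq : q ∈ stdSimplex ℝ (Fin l)) (hu' : ∀ x, u' x ∈ Set.Ico (0 : ℝ) 1) :
    IsEnrichment (fun x => u x < p) (env E F r q p u u')
      (env E (fun _ : Fin l => units d) r q p u u') where
  eq x hx := by
    ext e
    simp [env, localEnv, hx, hx.not_ge]
  eq_units x hx := by
    obtain ⟨j, hj⟩ := exists_mem_cell hq (hu' x)
    ext e
    constructor
    · rintro (⟨h, -⟩ | ⟨-, i, -, he⟩)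
      · exact absurd h hx
      · exact he
    · exact fun he => Or.inr ⟨not_lt.1 hx, j, hj, he⟩

end Environment

section Probability

variable {Ω : Type*} {mΩ : MeasurableSpace Ω} {P : Measure Ω}

/-- The endpoint `1` is discarded because it lies in no cell and would be of the second type when `p
= 1`. -/
theorem ae_mem_of_isUniform {X : Ω → ℝ} (hX : pdf.IsUniform X (Set.Ioc 0 1) P volume) :
    ∀ᵐ ω ∂P, X ω ∈ Set.Ioo (0 : ℝ) 1 := by
  have h := hX.measure_preimage (by simp) (by simp) (measurableSet_Ioo (a := (0 : ℝ)) (b := 1)).compl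
  rw [ae_iff]
  refine h.trans ?_
  have : Set.Ioc (0 : ℝ) 1 ∩ (Set.Ioo (0 : ℝ) 1)ᶜ ⊆ {1} := by
    rintro x ⟨h1, h2⟩
    by_contra hne
    exact h2 ⟨h1.1, lt_of_le_of_ne h1.2 hne⟩
  rw [measure_mono_null this (by simp), ENNReal.zero_div]

theorem measure_lt_of_isUniform {X : Ω → ℝ} (hX : pdf.IsUniform X (Set.Ioc 0 1) P volume) {p : ℝ}
    (hp : p ≤ 1) : P (X ⁻¹' Set.Iio p) = ENNReal.ofReal p := by
  rw [hX.measure_preimage (by simp) (by simp) measurableSet_Iio]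
  have : Set.Ioc (0 : ℝ) 1 ∩ Set.Iio p = Set.Ioo 0 p := by
    ext x
    constructor
    · exact fun h => ⟨h.1.1, h.2⟩
    · exact fun h => ⟨⟨h.1, h.2.le.trans hp⟩, h.2⟩
  rw [this]
  simp

variable {ι : Type*} {U : ι → Ω → ℝ} {S : Set ℝ} {θ : ℝ≥0∞}

theorem ae_coalesces [IsProbabilityMeasure P] (hU : ∀ x, Measurable (U x)) (hind : iIndepFun U P)
    (hS : MeasurableSet S)
    (hθ : ∀ x, P (U x ⁻¹' S) = θ) (h0 : θ ≠ 0) (h1 : θ < 1) {φ : ℤ → ℤ → ι}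
    (hφ : Function.Injective fun q : ℤ × ℤ => φ q.1 q.2) :
    ∀ᵐ ω ∂P, Coalesces fun k j => U (φ k j) ω ∈ S := by
  unfold Coalesces
  rw [ae_all_iff]
  intro k
  have hg : Function.Injective fun q : ℕ × ℤ => φ (k + q.1) q.2 := by
    intro q q' h
    have := hφ (a₁ := (k + q.1, q.2)) (a₂ := (k + q'.1, q'.2)) h
    simpa [Prod.ext_iff] using this
  exact ae_exists_flow_eq (A := fun n j => U (φ (k + n) j) ⁻¹' S) (fun q => (hU _).comap_le)
    (hind.iIndep.precomp hg) (fun i j => ⟨S, hS, rfl⟩) (fun i j => hθ _) h0 h1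

theorem ae_exists_mem [IsProbabilityMeasure P] (hU : ∀ x, Measurable (U x)) (hind : iIndepFun U P)
    (hS : MeasurableSet S) (hθ : ∀ x, P (U x ⁻¹' S) = θ) (h0 : θ ≠ 0) {φ : ℤ → ι}
    (hφ : Function.Injective φ) :
    ∀ᵐ ω ∂P, ∃ k : ℕ, U (φ k) ω ∈ S := by
  filter_upwards [ae_exists_stop (A := fun j => U (φ j) ⁻¹' S) (fun j => (hU _).comap_le)
    (hind.iIndep.precomp hφ) (fun j => ⟨S, hS, rfl⟩) (fun j => hθ _) h0] with ω hω
  obtain ⟨j, hj, h⟩ := hω 0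
  exact ⟨j.toNat, by rwa [Int.toNat_of_nonneg hj]⟩

theorem planePt_injective {d : ℕ} [NeZero d] {i : Fin d} (hi : i ≠ 0) (z : Site d) {h h' j j' : ℤ}
    (heq : planePt i z h j = planePt i z h' j') : h = h' ∧ j = j' := by
  have h1 := congrFun heq i
  have h2 := congrFun heq 0
  simp only [planePt, Function.update_self] at h1
  simp [planePt, hi.symm] at h2
  exact ⟨h1, h2⟩

theorem ae_regular {d : ℕ} [NeZero d] [IsProbabilityMeasure P] {U : Site d → Ω → ℝ}
    (hU : ∀ x, Measurable (U x)) (hind : iIndepFun U P)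
    (hunif : ∀ x, pdf.IsUniform (U x) (Set.Ioc 0 1) P volume) {p : ℝ} (hp : p ∈ Set.Ioo (0 : ℝ) 1) :
    ∀ᵐ ω ∂P, Regular fun x => U x ω < p := by
  have hθ : ∀ x, P (U x ⁻¹' Set.Iio p) = ENNReal.ofReal p := fun x =>
    measure_lt_of_isUniform (hunif x) hp.2.le
  have hθ' : ∀ x, P (U x ⁻¹' (Set.Iio p)ᶜ) = 1 - ENNReal.ofReal p := fun x => by
    rw [Set.preimage_compl, prob_compl_eq_one_sub (hU x measurableSet_Iio), hθ]
  have h0 : ENNReal.ofReal p ≠ 0 := (ENNReal.ofReal_pos.2 hp.1).ne'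
  have h1 : ENNReal.ofReal p < 1 := ENNReal.ofReal_lt_one.2 hp.2
  have h0' : 1 - ENNReal.ofReal p ≠ 0 := (tsub_pos_of_lt h1).ne'
  have h1' : 1 - ENNReal.ofReal p < 1 := ENNReal.sub_lt_self (by simp) (by simp) h0
  have hS : MeasurableSet (Set.Iio p) := measurableSet_Iio
  have hr : ∀ x : Site d, Function.Injective fun n : ℤ => x + n • e₁ d := fun x n n' h => by
    simpa [e₁] using congrFun h 0
  have hl : ∀ x : Site d, Function.Injective fun n : ℤ => x - n • e₁ d := fun x n n' h => by
    simpa [e₁] using congrFun h 0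
  have e1 : ∀ᵐ ω ∂P, ∀ x, ∃ k : ℕ, U (x - (k : ℤ) • e₁ d) ω ∈ Set.Iio p :=
    ae_all_iff.2 fun x => ae_exists_mem hU hind hS hθ h0 (hl x)
  have e2 : ∀ᵐ ω ∂P, ∀ x, ∃ k : ℕ, U (x + (k : ℤ) • e₁ d) ω ∈ (Set.Iio p)ᶜ :=
    ae_all_iff.2 fun x => ae_exists_mem hU hind hS.compl hθ' h0' (hr x)
  have e3 : ∀ᵐ ω ∂P, ∀ x, ∃ k : ℕ, U (x + (k : ℤ) • e₁ d) ω ∈ Set.Iio p :=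
    ae_all_iff.2 fun x => ae_exists_mem hU hind hS hθ h0 (hr x)
  -- Reflecting rows or columns turns downward or leftward paths into flows of the standard
  -- orientation.
  have e4 : ∀ᵐ ω ∂P, ∀ i : {i : Fin d // i ≠ 0}, ∀ z : Site d,
      Coalesces fun k j => U (planePt i.1 z (-k) j) ω ∈ (Set.Iio p)ᶜ :=
    ae_all_iff.2 fun i => ae_all_iff.2 fun z => ae_coalesces hU hind hS.compl hθ' h0' h1'
      (φ := fun k j => planePt i.1 z (-k) j) fun q q' h => by
        simpa [Prod.ext_iff] using planePt_injective i.2 z h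
  have e5 : ∀ᵐ ω ∂P, ∀ i : {i : Fin d // i ≠ 0}, ∀ z : Site d,
      Coalesces fun k j => U (planePt i.1 z k (-j)) ω ∈ Set.Iio p :=
    ae_all_iff.2 fun i => ae_all_iff.2 fun z => ae_coalesces hU hind hS hθ h0 h1
      (φ := fun k j => planePt i.1 z k (-j)) fun q q' h => by
        simpa [Prod.ext_iff] using planePt_injective i.2 z h
  have e6 : ∀ᵐ ω ∂P, ∀ i : {i : Fin d // i ≠ 0}, ∀ z : Site d,
      Coalesces fun k j => U (planePt i.1 z k j) ω ∈ (Set.Iio p)ᶜ :=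
    ae_all_iff.2 fun i => ae_all_iff.2 fun z => ae_coalesces hU hind hS.compl hθ' h0' h1'
      (φ := fun k j => planePt i.1 z k j) fun q q' h => by
        simpa [Prod.ext_iff] using planePt_injective i.2 z h
  filter_upwards [e1, e2, e3, e4, e5, e6] with ω w1 w2 w3 w4 w5 w6
  refine ⟨fun x => ?_, fun x => ?_, fun x => ?_, fun i hi z => w4 ⟨i, hi⟩ z,
    fun i hi z => w5 ⟨i, hi⟩ z, fun i hi z => w6 ⟨i, hi⟩ z⟩
  · simpa using w1 x
  · simpa using w2 x
  · simpa using w3 x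

end Probability

end DRE

theorem proposition4 {d k l : ℕ} [NeZero d]
    (E : Fin k → Set (DRE.Site d)) (F : Fin l → Set (DRE.Site d))
    (hE : ∀ i, E i ⊆ DRE.units d) (hF : ∀ j, F j ⊆ DRE.units d)
    (hcond : DRE.ModelCondition E F)
    (r : Fin k → ℝ) (hr : r ∈ stdSimplex ℝ (Fin k))
    (q : Fin l → ℝ) (hq : q ∈ stdSimplex ℝ (Fin l))
    (p : ℝ) (hp : p ∈ Set.Icc (0 : ℝ) 1)
    {Ω : Type*} [MeasurableSpace Ω] (P : Measure Ω) [IsProbabilityMeasure P]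
    (U U' : DRE.Site d → Ω → ℝ)
    (hU : ∀ x, Measurable (U x)) (hU' : ∀ x, Measurable (U' x))
    (hindep : iIndepFun (Sum.elim U U') P)
    (hunif : ∀ x, pdf.IsUniform (U x) (Set.Ioc 0 1) P volume)
    (hunif' : ∀ x, pdf.IsUniform (U' x) (Set.Ioc 0 1) P volume) :
    ∀ᵐ ω ∂P,
      let B : Set (DRE.Site d) :=
        DRE.backwardCluster (DRE.env E F r q p (fun x => U x ω) (fun x => U' x ω)) 0
      let Bstar : Set (DRE.Site d) :=
        DRE.backwardCluster
          (DRE.env E (fun _ : Fin l => DRE.units d) r q p (fun x => U x ω) (fun x => U' x ω)) 0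
      DRE.SemiFinite B ∨
        B = Bstar ∨
        (B = DRE.onePlus B ∧ B ≠ Set.univ ∧ Bstar = Set.univ) := by
  have hind : iIndepFun U P := hindep.precomp (g := Sum.inl) Sum.inl_injective
  have hreg : ∀ᵐ ω ∂P, p ∈ Set.Ioo (0 : ℝ) 1 → DRE.Regular fun x => U x ω < p := by
    by_cases h : p ∈ Set.Ioo (0 : ℝ) 1
    · filter_upwards [DRE.ae_regular hU hind hunif h] with ω hω _ using hω
    · exact Filter.Eventually.of_forall fun _ h' => absurd h' h
  filter_upwards [hreg, ae_all_iff.2 fun x => DRE.ae_mem_of_isUniform (hunif x),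
    ae_all_iff.2 fun x => DRE.ae_mem_of_isUniform (hunif' x)] with ω hR hu hu'
  have hu'' : ∀ x, U' x ω ∈ Set.Ico (0 : ℝ) 1 := fun x => ⟨(hu' x).1.le, (hu' x).2⟩
  have hO := hcond.offers (u := fun x => U x ω) (p := p) hE hF hr hq hu''
  have hEn := DRE.isEnrichment_env (E := E) (F := F) (r := r) (u := fun x => U x ω) (p := p) hq hu''
  rcases hp.1.eq_or_lt with h0 | h0
  · exact Or.inr (hEn.eq_or_of_forall_not hO (fun x => by
      rw [← h0]; exact (hu x).1.le.not_gt) 0)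
  · rcases hp.2.eq_or_lt with h1 | h1
    -- For `p = 1` every site is of the first type, so enrichment changes nothing.
    · refine Or.inr (Or.inl ?_)
      have : DRE.env E (fun _ : Fin l => DRE.units d) r q p (fun x => U x ω) (fun x => U' x ω) =
          DRE.env E F r q p (fun x => U x ω) (fun x => U' x ω) :=
        funext fun x => hEn.eq x (by rw [h1]; exact (hu x).2)
      rw [this]
    · exact hEn.semiFinite_or hO (hR ⟨h0, h1⟩) hcond.two_le 0
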